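/- A pushdown automaton (PDA) is $\mathcal P=(Q,\Sigma,\Gamma,\delta)$ with finite sets $Q,\Sigma,\Gamma$ of states, input letters and stack symbols and a finite transition relation $\delta\subseteq (Q\times\Sigma\times\Gamma)\times(Q\times\Gamma^*)$, where $(p,a,A,q,\gamma)\in\delta$ means that in state $p$, on input $a$, the top symbol $A$ is popped, $\gamma$ is pushed and the state becomes $q$. There is a bottom-of-stack symbol $\bot\in\Gamma$ such that every transition popping $\bot$ pushes a word ending in $\bot$. For $S\subseteq Q$, $a\in\Sigma$, $A\in\Gamma$ let $T^a_{S,A}$ be the set of $(p,a,A,q,\gamma)\in\delta$ with $p\in S$; two of its elements are equivalent if they push the same word. For an equivalence class $E$ let $\mathrm{word}(E)$ be that word and $\mathrm{next}(E)$ the set of target states $q$ of the transitions in $E$. Put $$\mathrm{Succ}(S,A\eta,a)=\{(\mathrm{next}(E),\mathrm{word}(E)\,\eta) : E \text{ an equivalence class of } T^a_{S,A}\}.$$ For $I\subseteq Q$, $\gamma\in\Gamma^*$ and $s\in Q$, a super-synchroniser between $(I,\gamma)$ and $s$ is a finite tree with vertices labelled by pairs in $2^Q\times\Gamma^*$ such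 that the root has label $(I,\gamma)$; all outgoing edges of a vertex carry the same input letter; every vertex that is not a leaf has a label of the form $(S,A\eta)$ and, if $a$ is the letter on its outgoing edges, its children are labelled by the elements of $\mathrm{Succ}(S,A\eta,a)$, each occurring exactly once; and every leaf has label $(\{s\},\bot)$. The problem Special-Sync is: given a PDA $\mathcal P$, a subset $I$ of its states and a state $s$, decide whether there is a super-synchroniser between $(I,\bot)$ and $s$. **Theorem.** Special-Sync is in $2\mathsf{EXPTIME}$: for a standard encoding of the inputs $(\mathcal P,I,s)$ by words over a fixed finite alphabet, there are a deterministic multi-tape Turing machine and a polynomial $p$ such that on every word of length $n$ the machine halts after at most $2^{2^{p(n)}}$ steps and accepts if and only if the word encodes an input $(\mathcal P,I,s)$ for which a super-synchroniser between $(I,\bot)$ and $s$ exists. -/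

import Mathlib

namespace AdaptiveSync

/-! ### Pushdown automata -/

/-- A transition `(src, top) --letter--> (dst, push)`: in state `src`, on reading `letter`, pop
`top`, move to `dst` and push the word `push` (its first symbol becomes the top of the stack). -/
structure Transition (Q A G : Type) where
  src : Q
  letter : A
  top : G
  dst : Q
  push : List G
  deriving DecidableEq

/-- A pushdown automaton with states `Q`, input alphabet `A`, stack alphabet `G` and
bottom-of-the-stack symbol `bot`: a transition that pops `bot` pushes it back in the bottom-most
position. -/
structure PDA (Q A G : Type) where
  bot : G
  delta : Finset (Transition Q A G)
  bot_push : ∀ t ∈ delta, t.top = bot → ∃ w : List G, t.push = w ++ [bot]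

/-- A pseudo-configuration `(S, γ)`: the observer knows that the current state lies in `S`, and
sees the stack content `γ` (top first). -/
abbrev PseudoConfig (Q G : Type) : Type := Finset Q × List G

namespace PDA

variable {Q A G : Type} [DecidableEq Q] [DecidableEq A] [DecidableEq G]

/-- The set `T^a_{S,X}` of the transitions that may take place on reading `a` when the state lies
in `S` and the top of the stack is `X`. -/
def possible (P : PDA Q A G) (S : Finset Q) (X : G) (a : A) : Finset (Transition Q A G) :=
  P.delta.filter fun t => t.src ∈ S ∧ t.letter = a ∧ t.top = X

/-- The equivalence class of `t` in `T^a_{S,X}` under the relation "push the same word". -/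
def indistClass (P : PDA Q A G) (S : Finset Q) (X : G) (a : A) (t : Transition Q A G) :
    Finset (Transition Q A G) :=
  (P.possible S X a).filter fun t' => t'.push = t.push

/-- `Succ(S, Xη, a)`: one pseudo-configuration `(next(E), word(E)η)` for each equivalence class
`E` of `T^a_{S,X}`. -/
def succs (P : PDA Q A G) (S : Finset Q) (X : G) (η : List G) (a : A) :
    Finset (PseudoConfig Q G) :=
  (P.possible S X a).image fun t =>
    ((P.indistClass S X a t).image Transition.dst, t.push ++ η)

end PDA

/-! ### Synchronisers -/

/-- Finite trees whose vertices are labelled by pseudo-configurations; a vertex that is not a leaf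
has `k` children, and all its outgoing edges carry the same input letter. -/
inductive Tree (Q A G : Type) : Type
  | leaf (c : PseudoConfig Q G) : Tree Q A G
  | node (c : PseudoConfig Q G) (a : A) (k : ℕ) (child : Fin k → Tree Q A G) : Tree Q A G

namespace Tree

variable {Q A G : Type}

/-- The label of the root. -/
def label : Tree Q A G → PseudoConfig Q G
  | leaf c => c
  | node c _ _ _ => c

/-- All leaves have labels that satisfy `p`. -/
def AllLeaves (p : PseudoConfig Q G → Prop) : Tree Q A G → Prop
  | leaf c => p c
  | node _ _ _ child => ∀ i, (child i).AllLeaves p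

/-- Every vertex that has outgoing edges has at least one child, its label is of the form
`(S, Xη)`, and its children are labelled by the elements of `Succ(S, Xη, a)`, each of them once,
where `a` is the letter on its outgoing edges. -/
def Respects [DecidableEq Q] [DecidableEq A] [DecidableEq G] (P : PDA Q A G) :
    Tree Q A G → Prop
  | leaf _ => True
  | node c a k child =>
      0 < k ∧
      (∃ (X : G) (η : List G), c.2 = X :: η ∧
        Function.Injective (fun i => (child i).label) ∧
        Set.range (fun i => (child i).label) = (P.succs c.1 X η a : Set (PseudoConfig Q G))) ∧
      ∀ i, (child i).Respects P

end Tree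

/-- `T` is a super-synchroniser between `(I, γ)` and `s` in `P`. -/
def IsSuperSynchroniser {Q A G : Type} [DecidableEq Q] [DecidableEq A] [DecidableEq G]
    (P : PDA Q A G) (I : Finset Q) (γ : List G) (s : Q) (T : Tree Q A G) : Prop :=
  T.label = (I, γ) ∧ T.Respects P ∧ T.AllLeaves fun c => c = ({s}, [P.bot])

/-! ### The problem and its encoding -/

/-- An input `(P, I, s)` of the problem. The finite sets are `{0, …, n - 1}`; the transition
relation and the subset `I` are given by listing their elements. -/
structure Instance where
  numStates : ℕ
  numLetters : ℕ
  numStack : ℕ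
  bot : Fin numStack
  rules : List (Transition (Fin numStates) (Fin numLetters) (Fin numStack))
  bot_push : ∀ t ∈ rules, t.top = bot → ∃ w : List (Fin numStack), t.push = w ++ [bot]
  initial : List (Fin numStates)
  target : Fin numStates

namespace Instance

/-- The pushdown automaton of an instance. -/
def pda (x : Instance) : PDA (Fin x.numStates) (Fin x.numLetters) (Fin x.numStack) where
  bot := x.bot
  delta := x.rules.toFinset
  bot_push := fun t ht => x.bot_push t (List.mem_toFinset.1 ht)

/-- There is a super-synchroniser between `(I, ⊥)` and `s`. -/
def IsPositive (x : Instance) : Prop :=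
  ∃ T, IsSuperSynchroniser x.pda x.initial.toFinset [x.bot] x.target T

end Instance

/-- The alphabet in which instances are written. -/
inductive Symbol
  | tally
  | comma
  | semicolon
  deriving DecidableEq

/-- A number in tally notation, closed by a comma. As the sets of an automaton count with their
cardinality in its size, this is polynomially related to binary notation for their elements. -/
def encodeNat (n : ℕ) : List Symbol :=
  List.replicate n Symbol.tally ++ [Symbol.comma]

/-- The entries of a list one after the other, closed by a semicolon. -/
def encodeList {α : Type} (f : α → List Symbol) (l : List α) : List Symbol :=
  l.flatMap f ++ [Symbol.semicolon]

def encodeFin {n : ℕ} (i : Fin n) : List Symbol := encodeNat i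

def encodeTransition {n m g : ℕ} (t : Transition (Fin n) (Fin m) (Fin g)) : List Symbol :=
  encodeFin t.src ++ (encodeFin t.letter ++ (encodeFin t.top ++ (encodeFin t.dst ++
    encodeList encodeFin t.push)))

def Instance.encode (x : Instance) : List Symbol :=
  encodeNat x.numStates ++ (encodeNat x.numLetters ++ (encodeNat x.numStack ++
    (encodeFin x.bot ++ (encodeFin x.target ++ (encodeList encodeFin x.initial ++
      encodeList encodeTransition x.rules)))))

/-- The problem Special-Sync, as a language. -/
def specialSync : Language Symbol :=
  {w | ∃ x : Instance, x.encode = w ∧ x.IsPositive}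

/-! ### The encoding is injective -/

theorem encodeNat_append_inj {a b : ℕ} {x y : List Symbol}
    (h : encodeNat a ++ x = encodeNat b ++ y) : a = b ∧ x = y := by
  induction a generalizing b with
  | zero =>
    cases b with
    | zero => simpa [encodeNat] using h
    | succ b => simp [encodeNat, List.replicate_succ] at h
  | succ a ih =>
    cases b with
    | zero => simp [encodeNat, List.replicate_succ] at h
    | succ b =>
      have h' : encodeNat a ++ x = encodeNat b ++ y := by
        simpa [encodeNat, List.replicate_succ] using h
      exact ⟨congrArg _ (ih h').1, (ih h').2⟩

theorem encodeNat_append_ne_semicolon (a : ℕ) (x y : List Symbol) :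
    encodeNat a ++ x ≠ Symbol.semicolon :: y := by
  cases a <;> simp [encodeNat, List.replicate_succ]

theorem encodeFin_append_inj {n : ℕ} {a b : Fin n} {x y : List Symbol}
    (h : encodeFin a ++ x = encodeFin b ++ y) : a = b ∧ x = y :=
  ⟨Fin.ext (encodeNat_append_inj h).1, (encodeNat_append_inj h).2⟩

theorem encodeList_append_inj {α : Type} {f : α → List Symbol}
    (hf : ∀ a b x y, f a ++ x = f b ++ y → a = b ∧ x = y)
    (hs : ∀ a x y, f a ++ x ≠ Symbol.semicolon :: y) {k l : List α} {x y : List Symbol}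
    (h : encodeList f k ++ x = encodeList f l ++ y) : k = l ∧ x = y := by
  induction k generalizing l with
  | nil =>
    cases l with
    | nil => simpa [encodeList] using h
    | cons b l =>
      simp only [encodeList, List.flatMap_nil, List.flatMap_cons, List.append_assoc,
        List.nil_append, List.cons_append] at h
      exact absurd h.symm (hs _ _ _)
  | cons a k ih =>
    cases l with
    | nil =>
      simp only [encodeList, List.flatMap_nil, List.flatMap_cons, List.append_assoc,
        List.nil_append, List.cons_append] at h
      exact absurd h (hs _ _ _)
    | cons b l =>
      simp only [encodeList, List.flatMap_cons, List.append_assoc] at h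
      obtain ⟨e₁, h₁⟩ := hf _ _ _ _ h
      obtain ⟨e₂, h₂⟩ := ih (l := l) (by simpa [encodeList] using h₁)
      exact ⟨by rw [e₁, e₂], h₂⟩

theorem encodeFinList_append_inj {n : ℕ} {k l : List (Fin n)} {x y : List Symbol}
    (h : encodeList encodeFin k ++ x = encodeList encodeFin l ++ y) : k = l ∧ x = y :=
  encodeList_append_inj (fun _ _ _ _ => encodeFin_append_inj)
    (fun a => encodeNat_append_ne_semicolon a) h

theorem encodeTransition_append_inj {n m g : ℕ} {s t : Transition (Fin n) (Fin m) (Fin g)}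
    {x y : List Symbol} (h : encodeTransition s ++ x = encodeTransition t ++ y) :
    s = t ∧ x = y := by
  obtain ⟨s₁, s₂, s₃, s₄, s₅⟩ := s
  obtain ⟨t₁, t₂, t₃, t₄, t₅⟩ := t
  simp only [encodeTransition, List.append_assoc] at h
  obtain ⟨rfl, h1⟩ := encodeFin_append_inj h
  obtain ⟨rfl, h2⟩ := encodeFin_append_inj h1
  obtain ⟨rfl, h3⟩ := encodeFin_append_inj h2
  obtain ⟨rfl, h4⟩ := encodeFin_append_inj h3
  obtain ⟨rfl, h5⟩ := encodeFinList_append_inj h4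
  exact ⟨rfl, h5⟩

/-- Different instances are written differently, so a word determines its instance. -/
theorem Instance.encode_injective : Function.Injective Instance.encode := by
  rintro ⟨n, m, g, b, r, hb, i, s⟩ ⟨n', m', g', b', r', hb', i', s'⟩ h
  simp only [Instance.encode] at h
  obtain ⟨rfl, h1⟩ := encodeNat_append_inj h
  obtain ⟨rfl, h2⟩ := encodeNat_append_inj h1
  obtain ⟨rfl, h3⟩ := encodeNat_append_inj h2
  obtain ⟨rfl, h4⟩ := encodeFin_append_inj h3
  obtain ⟨rfl, h5⟩ := encodeFin_append_inj h4
  obtain ⟨rfl, h6⟩ := encodeFinList_append_inj h5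
  obtain ⟨rfl, -⟩ := encodeList_append_inj (f := @encodeTransition n m g) (x := []) (y := [])
    (fun _ _ _ _ => encodeTransition_append_inj)
    (fun t x y => by
      rw [encodeTransition, List.append_assoc]
      exact encodeNat_append_ne_semicolon _ _ _) (by simpa using h6)
  rfl

/-! ### Doubly exponential time -/

open Classical in
/-- The languages over `α` that some deterministic Turing machine (with finitely many stacks, that
is, multi-tape) decides in at most `2 ^ (2 ^ p(n))` steps on all inputs of length `n`, for some
polynomial `p`. -/
def TwoEXPTIME (α : Type) : Set (Language α) :=
  {L | ∃ (p : Polynomial ℕ)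
      (M : Turing.TM2ComputableInTime (id : List α → List α) Computability.encodeBool
        (fun w => decide (w ∈ L))),
      ∀ n, M.time n ≤ 2 ^ 2 ^ p.eval n}

end AdaptiveSync

/-! ### Turing machines obtained from structured stack programs. -/

namespace AdaptiveSync

open Function Turing

/-! Reaching the label `({s}, ⊥)` can be regarded as popping `⊥` from `{s}` and landing in the empty
set of states. With this convention `Wins P s F S γ` expresses that from `(S, γ)` the observer can
force the stack to be used up with a set in the family `F`. No real move leads to the empty set, and
from the empty set no move is possible, so the fictitious pop counts only where `⊥` is the whole
stack. Hence, on a nonempty stack, winning for `F = {∅}` is the same as having a super-synchroniser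
(`exists_superSynchroniser_iff`).

The gain is that winning is compositional in the stack: to win on `γ ++ η` for `F` it suffices to
win on `γ` for a family of sets from which `η` is won for `F` (`Wins.append`). Families are needed
because different branches of a tree pop the same symbol with different resulting sets. Everything
is thus governed by the triples `(S, X, F)` for which `X` can be popped from `S` into `F`. They are
computed by a monotone saturation, which is sound by `Wins.of_round` and complete at a fixed point
by `Wins.mem_back`. With `n` states and `g` stack symbols there are `2^n * g * 2^(2^n)` triples, so
doubly exponentially many rounds reach the fixed point (`PDA.round_fixed`), and one entry gives the
answer (`exists_superSynchroniser_iff_round`).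

For the time bound, the algorithm is written in a small functional language `Code` on words, which
is compiled through register programs to a Turing machine. The running time of a fixed program is
polynomial in the length of the longest word that it builds (`Code.run_compile`,
`Code.polyBounded_time`). `Feas` is a calculus of functions whose programs build only polynomially
long words, with numbers in unary. The saturation is feasible once `2^|w|` and `2^(2^|w|)` are
supplied in unary as further arguments (`Feas.accepts`). Only these two numbers are made outside the
calculus, by `doubling`. A power of a double exponential is still doubly exponential
(`add_two_le_tower`), and `accepts_iff_mem` connects the table on words with the fixed point. -/

instance : Fintype Symbol :=
  ⟨{Symbol.tally, Symbol.comma, Symbol.semicolon}, fun c => by cases c <;> simp⟩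

/-! ### Structured programs over registers holding words -/

/-- The contents of the registers. -/
abbrev Store : Type := ℕ → List Symbol

/-- Structured programs that use their registers as stacks. -/
inductive StackProg : Type
  | skip : StackProg
  | push (r : ℕ) (c : Symbol) : StackProg
  | seq (p q : StackProg) : StackProg
  | pop (r : ℕ) (p : Option Symbol → StackProg) : StackProg
  | loop (r : ℕ) (p : Symbol → StackProg) : StackProg

namespace StackProg

/-- `Run p s t s'`: started in the store `s`, the program `p` ends after at most `t` steps in the
store `s'`. -/
inductive Run : StackProg → Store → ℕ → Store → Prop
  | skip (s : Store) : Run skip s 1 s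
  | push (r : ℕ) (c : Symbol) (s : Store) : Run (push r c) s 1 (update s r (c :: s r))
  | seq {p q : StackProg} {s s' s'' : Store} {t t' : ℕ} :
      Run p s t s' → Run q s' t' s'' → Run (seq p q) s (t + t') s''
  | pop {r : ℕ} {p : Option Symbol → StackProg} {s s' : Store} {t : ℕ} :
      Run (p (s r).head?) (update s r (s r).tail) t s' → Run (pop r p) s (t + 1) s'
  | loop_nil {r : ℕ} {p : Symbol → StackProg} {s : Store} : s r = [] → Run (loop r p) s 1 s
  | loop_cons {r : ℕ} {p : Symbol → StackProg} {s s' s'' : Store} {t t' : ℕ} {c : Symbol}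
      {l : List Symbol} : s r = c :: l → Run (p c) (update s r l) t s' →
      Run (loop r p) s' t' s'' → Run (loop r p) s (t + t' + 1) s''
  | mono {p : StackProg} {s s' : Store} {t t' : ℕ} : Run p s t s' → t ≤ t' → Run p s t' s'

/-- The positions in a program. -/
def Lab : StackProg → Type
  | skip => Unit
  | push _ _ => Unit
  | seq p q => Lab p ⊕ Lab q
  | pop _ p => Option (Σ o, Lab (p o))
  | loop _ p => Option (Σ c, Lab (p c))

/-- A `FinTM2` needs finitely many labels. The recursion succeeds because programs branch only over
`Symbol` or `Option Symbol`. -/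
noncomputable instance fintypeLab : (p : StackProg) → Fintype (Lab p)
  | skip => inferInstanceAs (Fintype Unit)
  | push _ _ => inferInstanceAs (Fintype Unit)
  | seq p q =>
    letI := fintypeLab p
    letI := fintypeLab q
    inferInstanceAs (Fintype (Lab p ⊕ Lab q))
  | pop _ p =>
    letI := fun o => fintypeLab (p o)
    inferInstanceAs (Fintype (Option (Σ o, Lab (p o))))
  | loop _ p =>
    letI := fun o => fintypeLab (p o)
    inferInstanceAs (Fintype (Option (Σ o, Lab (p o))))

/-- The first position of a program. -/
def entry : (p : StackProg) → Lab p
  | skip => ()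
  | push _ _ => ()
  | seq p _ => .inl (entry p)
  | pop _ _ => none
  | loop _ _ => none

/-- The largest register of a program. -/
def maxReg : StackProg → ℕ
  | skip => 0
  | push r _ => r
  | seq p q => max (maxReg p) (maxReg q)
  | pop r p => max r (Finset.univ.sup fun o => maxReg (p o))
  | loop r p => max r (Finset.univ.sup fun o => maxReg (p o))

/-- The alphabets of the stacks: one stack for each register and one for the answer. -/
abbrev Alph (m : ℕ) : Option (Fin (m + 1)) → Type
  | none => Bool
  | some _ => Symbol

/-- The stack of a register. -/
abbrev reg (m r : ℕ) : Option (Fin (m + 1)) := some (Fin.ofNat (m + 1) r)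

/-- The statement at a position of a program that is embedded into a machine. -/
def stmt (m : ℕ) {Λ : Type} : (p : StackProg) → (Lab p → Λ) → Λ → Lab p →
    TM2.Stmt (Alph m) Λ (Option Symbol)
  | skip, _, ex, _ => .goto fun _ => ex
  | push r c, _, ex, _ => .push (reg m r) (fun _ => c) (.goto fun _ => ex)
  | seq p q, emb, _, .inl l => stmt m p (fun x => emb (.inl x)) (emb (.inr (entry q))) l
  | seq _ q, emb, ex, .inr l => stmt m q (fun x => emb (.inr x)) ex l
  | pop r p, emb, _, none =>
    .pop (reg m r) (fun _ o => o) (.goto fun o => emb (some ⟨o, entry (p o)⟩))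
  | pop _ p, emb, ex, some ⟨o, l⟩ => stmt m (p o) (fun x => emb (some ⟨o, x⟩)) ex l
  | loop r p, emb, ex, none =>
    .pop (reg m r) (fun _ o => o) (.goto fun o => match o with
      | none => ex
      | some c => emb (some ⟨c, entry (p c)⟩))
  | loop _ p, emb, _, some ⟨o, l⟩ => stmt m (p o) (fun x => emb (some ⟨o, x⟩)) (emb none) l

/-- The stacks that hold a store. -/
def stackStore (m : ℕ) (s : Store) : (k : Option (Fin (m + 1))) → List (Alph m k)
  | none => []
  | some i => s i

/-- `reg` reduces register numbers modulo `m + 1`; the bound `r ≤ m` prevents two registers from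
sharing a stack. -/
theorem stackStore_reg {m r : ℕ} (h : r ≤ m) (s : Store) :
    stackStore m s (reg m r) = s r := by
  have : r % (m + 1) = r := Nat.mod_eq_of_lt (by omega)
  exact congrArg s this

theorem update_stackStore {m r : ℕ} (h : r ≤ m) (s : Store) (l : List Symbol) :
    update (stackStore m s) (reg m r) l = stackStore m (update s r l) := by
  have hr : r % (m + 1) = r := Nat.mod_eq_of_lt (by omega)
  funext k
  rcases eq_or_ne k (reg m r) with rfl | hk
  · rw [update_self, stackStore_reg h, update_self]
  · rw [update_of_ne hk]
    rcases k with _ | i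
    · rfl
    · have hi : (i : ℕ) ≠ r := fun hi => hk (congrArg some (Fin.ext (hi.trans hr.symm)))
      exact (update_of_ne hi l s).symm

theorem stepAux_push {m r : ℕ} (h : r ≤ m) {Λ : Type} (c : Symbol)
    (q : TM2.Stmt (Alph m) Λ (Option Symbol)) (v : Option Symbol) (s : Store) :
    TM2.stepAux (.push (reg m r) (fun _ => c) q) v (stackStore m s) =
      TM2.stepAux q v (stackStore m (update s r (c :: s r))) := by
  rw [← update_stackStore h, ← stackStore_reg h s]
  rfl

theorem stepAux_pop {m r : ℕ} (h : r ≤ m) {Λ : Type}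
    (q : TM2.Stmt (Alph m) Λ (Option Symbol)) (v : Option Symbol) (s : Store) :
    TM2.stepAux (.pop (reg m r) (fun _ o => o) q) v (stackStore m s) =
      TM2.stepAux q (s r).head? (stackStore m (update s r (s r).tail)) := by
  rw [← update_stackStore h, ← stackStore_reg h s]
  rfl

/-- Iterated steps of a machine. -/
def Steps {m : ℕ} {Λ : Type} (M : Λ → TM2.Stmt (Alph m) Λ (Option Symbol)) (t : ℕ)
    (c c' : TM2.Cfg (Alph m) Λ (Option Symbol)) : Prop :=
  ∃ n ≤ t, (flip bind (TM2.step M))^[n] (some c) = some c'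

section Steps

variable {m : ℕ} {Λ : Type} {M : Λ → TM2.Stmt (Alph m) Λ (Option Symbol)}
  {c c' c'' : TM2.Cfg (Alph m) Λ (Option Symbol)} {t t' : ℕ}

theorem Steps.mono (h : Steps M t c c') (ht : t ≤ t') : Steps M t' c c' :=
  let ⟨n, hn, e⟩ := h
  ⟨n, hn.trans ht, e⟩

theorem Steps.trans (h : Steps M t c c') (h' : Steps M t' c' c'') : Steps M (t + t') c c'' := by
  obtain ⟨n, hn, e⟩ := h
  obtain ⟨n', hn', e'⟩ := h'
  exact ⟨n' + n, by omega, by rw [iterate_add_apply, e, e']⟩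

theorem Steps.one (h : TM2.step M c = some c') : Steps M 1 c c' :=
  ⟨1, le_rfl, by simpa [flip] using h⟩

end Steps

/-- Generality in the embedding `emb` and the exit `ex` lets every subprogram live inside one
machine: the first half of a `seq` exits to the entry of the second, a loop body to the head of its
loop. The final internal state does not matter, since every `goto` that reads it directly follows a
pop that sets it. -/
theorem Run.steps {m : ℕ} {Λ : Type} {M : Λ → TM2.Stmt (Alph m) Λ (Option Symbol)}
    {p : StackProg} {s s' : Store} {t : ℕ} (h : Run p s t s') (hm : p.maxReg ≤ m)
    (emb : Lab p → Λ) (ex : Λ) (hM : ∀ l, M (emb l) = stmt m p emb ex l) (v : Option Symbol) :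
    ∃ v', Steps M t ⟨some (emb (entry p)), v, stackStore m s⟩ ⟨some ex, v', stackStore m s'⟩ := by
  induction h generalizing Λ v with
  | skip s =>
    exact ⟨v, .one (by rw [TM2.step, hM]; rfl)⟩
  | push r c s =>
    exact ⟨v, .one (congrArg some ((congrArg (fun q => TM2.stepAux q v _) (hM ())).trans
      (stepAux_push hm _ _ _ _)))⟩
  | seq _ _ ih₁ ih₂ =>
    obtain ⟨v₁, h₁⟩ := ih₁ (le_trans (le_max_left _ _) hm) (fun x => emb (.inl x)) _
      (fun l => hM (.inl l)) v
    obtain ⟨v₂, h₂⟩ := ih₂ (le_trans (le_max_right _ _) hm) (fun x => emb (.inr x)) ex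
      (fun l => hM (.inr l)) v₁
    exact ⟨v₂, h₁.trans h₂⟩
  | @pop r p s s' t _ ih =>
    have hr : r ≤ m := le_trans (le_max_left _ _) hm
    have hp : ∀ o, (p o).maxReg ≤ m := fun o =>
      le_trans (Finset.le_sup (f := fun o => maxReg (p o)) (Finset.mem_univ o))
        (le_trans (le_max_right _ _) hm)
    obtain ⟨v₁, h₁⟩ := ih (hp _) (fun x => emb (some ⟨_, x⟩)) ex (fun l => hM (some ⟨_, l⟩))
      (s r).head?
    refine ⟨v₁, Steps.mono (Steps.trans (.one ?_) h₁) (Nat.add_comm 1 t).le⟩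
    exact congrArg some ((congrArg (fun q => TM2.stepAux q v _) (hM none)).trans
      (stepAux_pop hr _ _ _))
  | @loop_nil r p s hs =>
    have hr : r ≤ m := le_trans (le_max_left _ _) hm
    refine ⟨none, .one ?_⟩
    refine congrArg some ((congrArg (fun q => TM2.stepAux q v _) (hM none)).trans
      ((stepAux_pop hr _ _ _).trans ?_))
    -- Popping an empty stack changes nothing, so the test that ends the loop leaves the store
    -- intact.
    have e : update s r (s r).tail = s := by rw [hs, List.tail_nil, ← hs, update_eq_self]
    rw [e, hs]
    rfl
  | @loop_cons r p s s' s'' t t' c l hs _ _ ih₁ ih₂ =>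
    have hr : r ≤ m := le_trans (le_max_left _ _) hm
    have hp : ∀ o, (p o).maxReg ≤ m := fun o =>
      le_trans (Finset.le_sup (f := fun o => maxReg (p o)) (Finset.mem_univ o))
        (le_trans (le_max_right _ _) hm)
    obtain ⟨v₁, h₁⟩ := ih₁ (hp _) (fun x => emb (some ⟨_, x⟩)) (emb none)
      (fun l => hM (some ⟨_, l⟩)) (some c)
    obtain ⟨v₂, h₂⟩ := ih₂ hm emb ex hM v₁
    refine ⟨v₂, Steps.mono (Steps.trans (Steps.trans (.one ?_) h₁) h₂) (by omega)⟩
    refine congrArg some ((congrArg (fun q => TM2.stepAux q v _) (hM none)).trans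
      ((stepAux_pop hr _ _ _).trans ?_))
    rw [hs]
    rfl
  | mono _ ht ih =>
    obtain ⟨v', h⟩ := ih hm emb ex hM v
    exact ⟨v', h.mono ht⟩

/-- The machine that runs a program on the word in register `0` and answers whether register `1`
is nonempty in the end. -/
noncomputable def machine (p : StackProg) : FinTM2 where
  K := Option (Fin (p.maxReg + 2))
  k₀ := reg (p.maxReg + 1) 0
  k₁ := none
  Γ := Alph (p.maxReg + 1)
  Λ := Option (Lab p)
  main := some (entry p)
  σ := Option Symbol
  initialState := none
  Γk₀Fin := inferInstanceAs (Fintype Symbol)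
  m
    | some l => stmt (p.maxReg + 1) p some none l
    | none => .pop (reg (p.maxReg + 1) 1) (fun _ o => o)
        (.push none (fun o => o.isSome) (.load (fun _ => none) .halt))

/-- `haltList` demands that every stack except the output is empty. So the program must leave only
register `1` possibly nonempty, and the closing statement, which costs the extra step, pops it. -/
theorem machine_outputs {p : StackProg} {w : List Symbol} {b : Bool} {t : ℕ}
    (h : Run p (update (fun _ => []) 0 w) t
      (update (fun _ => []) 1 (if b then [Symbol.tally] else []))) :
    Nonempty (TM2OutputsInTime (machine p) w (some [b]) (t + 1)) := by
  -- One more than `maxReg`, so that register `1` has a stack even if the program never mentions it.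
  set m := p.maxReg + 1 with hm
  obtain ⟨v, hv⟩ := h.steps (M := (machine p).m) (m := m) (by omega) some none
    (fun _ => rfl) none
  have e₀ : initList (machine p) w =
      ⟨some (some (entry p)), none, stackStore m (update (fun _ => []) 0 w)⟩ := by
    rw [← update_stackStore (by omega)]
    refine congrArg (TM2.Cfg.mk (some (some (entry p))) none) ?_
    refine funext fun (k : Option (Fin (m + 1))) => ?_
    by_cases hk : k = reg m 0
    · subst hk
      refine (dif_pos rfl).trans ?_
      rw [update_self]
      rfl
    · refine (dif_neg hk).trans ?_
      rw [update_of_ne hk]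
      rcases k with _ | k <;> rfl
  have e₁ : TM2.stepAux ((machine p).m none) v
      (stackStore m (update (fun _ => []) 1 (if b then [Symbol.tally] else []))) =
        haltList (machine p) [b] := by
    refine (stepAux_pop (by omega) _ _ _).trans ?_
    have e₂ : (if b then [Symbol.tally] else []).tail = ([] : List Symbol) := by cases b <;> rfl
    have e₃ : (if b then [Symbol.tally] else ([] : List Symbol)).head?.isSome = b := by
      cases b <;> rfl
    rw [update_self, update_idem, e₂, update_eq_self]
    refine congrArg (TM2.Cfg.mk none none) ?_
    funext k
    rcases k with _ | k
    · exact (update_self _ _ _).trans (congrArg (fun x => [x]) e₃)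
    · exact update_of_ne (by simp) _ _
  have key : Steps (machine p).m (t + 1) (initList (machine p) w) (haltList (machine p) [b]) := by
    rw [e₀]
    exact hv.trans (.one (congrArg some e₁))
  obtain ⟨n, hn, e⟩ := key
  exact ⟨⟨⟨n, e⟩, hn⟩⟩

end StackProg

end AdaptiveSync

/-! ### Compilation of functional programs and a polynomial bound on their running time. -/

namespace AdaptiveSync

open Function

namespace StackProg

theorem Run.congr {p : StackProg} {s s₁ s₂ : Store} {t₁ t₂ : ℕ} (h : Run p s t₁ s₁)
    (hs : s₁ = s₂) (ht : t₁ ≤ t₂) : Run p s t₂ s₂ :=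
  hs ▸ h.mono ht

/-- Empty a register. -/
def clear (r : ℕ) : StackProg := loop r fun _ => skip

/-- Move a register on top of another one, in reverse order. -/
def moveRev (r t : ℕ) : StackProg := loop r fun c => push t c

/-- Move a register into an empty one, through a third one. -/
def move (r t u : ℕ) : StackProg := seq (moveRev r u) (moveRev u t)

/-- Copy a register into an empty one, through a third one. -/
def copy (r t u : ℕ) : StackProg :=
  seq (moveRev r u) (loop u fun c => seq (push r c) (push t c))

theorem run_clear (r : ℕ) (s : Store) : Run (clear r) s (2 * (s r).length + 1) (update s r []) := by
  generalize h : s r = l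
  induction l generalizing s with
  | nil => exact (Run.loop_nil h).congr (by rw [← h, update_eq_self]) (by simp)
  | cons c l ih =>
    exact (Run.loop_cons h (.skip _) (ih _ (update_self ..))).congr (by rw [update_idem])
      (by simp only [List.length_cons]; omega)

theorem run_moveRev {r t : ℕ} (hrt : r ≠ t) (s : Store) :
    Run (moveRev r t) s (2 * (s r).length + 1)
      (update (update s r []) t ((s r).reverse ++ s t)) := by
  generalize h : s r = l
  induction l generalizing s with
  | nil =>
    exact (Run.loop_nil h).congr (by rw [← h, update_eq_self, h]; simp) (by simp)
  | cons c l ih =>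
    refine (Run.loop_cons h (.push _ _ _) (ih _ ?_)).congr ?_
      (by simp only [List.length_cons]; omega)
    · rw [update_of_ne hrt, update_self]
    · funext k
      simp only [update_apply]
      split_ifs <;> simp_all

theorem run_move {r t u : ℕ} (hrt : r ≠ t) (hru : r ≠ u) (htu : t ≠ u) {s : Store}
    (ht : s t = []) (hu : s u = []) :
    Run (move r t u) s (4 * (s r).length + 2) (update (update s r []) t (s r)) := by
  refine (Run.seq (run_moveRev hru s) (run_moveRev htu.symm _)).congr ?_ ?_
  · funext k
    simp only [update_apply]
    split_ifs <;> simp_all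
  · simp only [update_self, hu, List.append_nil, List.length_reverse]
    omega

theorem run_copy {r t u : ℕ} (hrt : r ≠ t) (hru : r ≠ u) (htu : t ≠ u) {s : Store}
    (ht : s t = []) (hu : s u = []) :
    Run (copy r t u) s (5 * (s r).length + 2) (update s t (s r)) := by
  have key : ∀ (l : List Symbol) (s : Store), s u = l →
      Run (loop u fun c => seq (push r c) (push t c)) s (3 * l.length + 1)
        (update (update (update s u []) r (l.reverse ++ s r)) t (l.reverse ++ s t)) := by
    intro l
    induction l with
    | nil =>
      intro s h
      refine (Run.loop_nil h).congr ?_ (by simp)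
      funext k
      simp only [update_apply]
      split_ifs <;> simp_all
    | cons c l ih =>
      intro s h
      refine (Run.loop_cons h (.seq (.push _ _ _) (.push _ _ _)) (ih _ ?_)).congr ?_
        (by simp only [List.length_cons]; omega)
      · rw [update_of_ne htu.symm, update_of_ne hru.symm, update_self]
      · funext k
        simp only [update_apply]
        split_ifs <;> simp_all
  refine (Run.seq (run_moveRev hru s) (key _ _ rfl)).congr ?_ ?_
  · funext k
    simp only [update_apply]
    split_ifs <;> simp_all
  · simp only [update_self, hu, List.append_nil, List.length_reverse]
    omega

/-- Case distinction on an optional symbol. -/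
def branch (p : StackProg) (q : Symbol → StackProg) : Option Symbol → StackProg
  | none => p
  | some c => q c

/-- Replace the word in a register by the one in the next register. -/
def retract (p : StackProg) (b : ℕ) : StackProg :=
  seq p (seq (clear b) (move (b + 1) b (b + 2)))

/-- Serves to close the scope of a local variable: `b` held the variable, `p` left its result just
above, and the result takes the place of the variable. -/
theorem run_retract {p : StackProg} {s₀ s : Store} {b t : ℕ} {w : List Symbol}
    (h : Run p s₀ t (update s (b + 1) w)) (hs : ∀ r, b + 1 ≤ r → s r = []) :
    Run (retract p b) s₀ (t + (2 * (s b).length + 4 * w.length + 3)) (update s b w) := by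
  refine (Run.seq h (Run.seq (run_clear b _) (run_move (by omega) (by omega) (by omega)
    (update_self ..) ?_))).congr ?_ ?_
  · rw [update_of_ne (by omega), update_of_ne (by omega)]
    exact hs _ (by omega)
  · funext k
    have := hs k
    simp only [update_apply]
    split_ifs <;> simp_all
  · rw [update_of_ne (by omega), update_of_ne (by omega), update_self]
    omega

/-- A round of a counting loop: the new value replaces the old one, and the counter is
increased. -/
def round (p : StackProg) (b : ℕ) : StackProg :=
  seq p (seq (clear (b + 1)) (seq (move (b + 3) (b + 1) (b + 4)) (push (b + 2) .tally)))

theorem run_round {p : StackProg} {s : Store} {b t : ℕ} {w : List Symbol}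
    (h : Run p s t (update s (b + 3) w)) (hs : ∀ r, b + 3 ≤ r → s r = []) :
    Run (round p b) s (t + (2 * (s (b + 1)).length + 4 * w.length + 4))
      (update (update s (b + 1) w) (b + 2) (.tally :: s (b + 2))) := by
  refine (Run.seq h (Run.seq (run_clear _ _) (Run.seq (run_move (by omega) (by omega) (by omega)
    (update_self ..) ?_) (.push _ _ _)))).congr ?_ ?_
  · rw [update_of_ne (by omega), update_of_ne (by omega)]
    exact hs _ (by omega)
  · funext k
    have := hs k
    simp only [update_apply]
    split_ifs <;> simp_all
  · rw [update_of_ne (by omega), update_of_ne (by omega), update_self]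
    omega

end StackProg

/-! ### Functional programs over words -/

/-- The result of `n` rounds of an iteration that knows the number of the round. -/
def iter {α : Type} (s : ℕ → α → α) (x : α) : ℕ → α
  | 0 => x
  | n + 1 => s n (iter s x n)

/-- A number as a word. -/
abbrev tallies (n : ℕ) : List Symbol := List.replicate n Symbol.tally

/-- Functional programs that map a list of words, their arguments, to a word. -/
inductive Code : Type
  | nil : Code
  | arg (i : ℕ) : Code
  | cons (c : Symbol) (f : Code) : Code
  | cases (f a : Code) (b : Symbol → Code) : Code
  | bind (f g : Code) : Code
  | ren (ρ : List ℕ) (f : Code) : Code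
  | loop (n x s : Code) : Code

namespace Code

/-- The value of a program. -/
def eval : Code → List (List Symbol) → List Symbol
  | nil, _ => []
  | arg i, e => e.getD i []
  | cons c f, e => c :: eval f e
  | cases f a b, e => match eval f e with
    | [] => eval a e
    | c :: l => eval (b c) (l :: e)
  | bind f g, e => eval g (eval f e :: e)
  | ren ρ f, e => eval f (ρ.map fun i => e.getD i [])
  | loop n x s, e =>
    iter (fun i v => eval s (tallies i :: v :: e)) (eval x e) (eval n e).length

/-- All words that a program builds have length at most `B`. -/
def Fits (B : ℕ) : Code → List (List Symbol) → Prop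
  | nil, _ => True
  | arg _, _ => True
  | cons _ f, e => Fits B f e ∧ (eval f e).length + 1 ≤ B
  | cases f a b, e => Fits B f e ∧ match eval f e with
    | [] => Fits B a e
    | c :: l => Fits B (b c) (l :: e)
  | bind f g, e => Fits B f e ∧ Fits B g (eval f e :: e)
  | ren ρ f, e => Fits B f (ρ.map fun i => e.getD i [])
  | loop n x s, e => Fits B n e ∧ Fits B x e ∧ ∀ i < (eval n e).length,
      Fits B s (tallies i :: iter (fun i v => eval s (tallies i :: v :: e)) (eval x e) i :: e)

theorem length_getD_le {e : List (List Symbol)} {B : ℕ} (he : ∀ v ∈ e, v.length ≤ B) (i : ℕ) :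
    (e.getD i []).length ≤ B := by
  rw [List.getD_eq_getElem?_getD]
  rcases h : e[i]? with _ | v
  · simp
  · exact he v (List.mem_of_getElem? h)

theorem forall_mem_ren {e : List (List Symbol)} {B : ℕ} (he : ∀ v ∈ e, v.length ≤ B)
    (ρ : List ℕ) : ∀ v ∈ ρ.map fun i => e.getD i [], v.length ≤ B := by
  intro v hv
  obtain ⟨i, -, rfl⟩ := List.mem_map.1 hv
  exact length_getD_le he i

theorem Fits.mono {B B' : ℕ} (hB : B ≤ B') {c : Code} {e : List (List Symbol)}
    (h : Fits B c e) : Fits B' c e := by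
  induction c generalizing e with
  | nil => trivial
  | arg => trivial
  | cons c f ih => exact ⟨ih h.1, h.2.trans hB⟩
  | cases f a b ihf iha ihb =>
    rw [Fits] at h ⊢
    obtain ⟨h₁, h₂⟩ := h
    refine ⟨ihf h₁, ?_⟩
    split at h₂
    · exact iha h₂
    · exact ihb _ h₂
  | bind f g ihf ihg => exact ⟨ihf h.1, ihg h.2⟩
  | ren ρ f ih => exact ih (e := ρ.map fun i => e.getD i []) h
  | loop n x s ihn ihx ihs => exact ⟨ihn h.1, ihx h.2.1, fun i hi => ihs (h.2.2 i hi)⟩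

/-- Words grow only at `cons`, where `Fits` checks them. All others are arguments, tails, or loop
counters, and a counter stays below the length of the word that controls the loop. -/
theorem length_eval_le {B : ℕ} {c : Code} {e : List (List Symbol)} (h : Fits B c e)
    (he : ∀ v ∈ e, v.length ≤ B) : (eval c e).length ≤ B := by
  induction c generalizing e with
  | nil => exact Nat.zero_le B
  | arg i => exact length_getD_le he i
  | cons c f ih => exact h.2
  | cases f a b ihf iha ihb =>
    rw [Fits] at h
    obtain ⟨h₁, h₂⟩ := h
    have h₃ := ihf h₁ he
    rw [eval]
    split at h₂
    next h₄ => exact iha h₂ he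
    next c l h₄ =>
      rw [h₄] at h₃
      exact ihb c h₂ (List.forall_mem_cons.2 ⟨le_trans (Nat.le_succ _) h₃, he⟩)
  | bind f g ihf ihg => exact ihg h.2 (List.forall_mem_cons.2 ⟨ihf h.1 he, he⟩)
  | ren ρ f ih => exact ih (e := ρ.map fun i => e.getD i []) h (forall_mem_ren he ρ)
  | loop n x s ihn ihx ihs =>
    have hn := ihn h.1 he
    have key : ∀ i ≤ (eval n e).length,
        (iter (fun i v => eval s (tallies i :: v :: e)) (eval x e) i).length ≤ B := by
      intro i
      induction i with
      | zero => exact fun _ => ihx h.2.1 he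
      | succ i ih =>
        intro hi
        refine ihs (h.2.2 i hi) (List.forall_mem_cons.2 ⟨?_, List.forall_mem_cons.2 ⟨?_, he⟩⟩)
        · rw [List.length_replicate]; omega
        · exact ih (by omega)
    exact key _ le_rfl

open StackProg (clear copy branch retract round Run)

/-- The stack program for a functional program whose arguments are in the registers `args`
(`none` stands for the empty word). The result goes to register `b`; the registers above `b` are
free. -/
def compile : Code → List (Option ℕ) → ℕ → StackProg
  | nil, _, _ => .skip
  | arg i, args, b => match args.getD i none with
    | none => .skip
    | some r => copy r b (b + 1)
  | cons c f, args, b => .seq (compile f args b) (.push b c)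
  | cases f a g, args, b => .seq (compile f args b) (.pop b (branch (compile a args b)
      fun c => retract (compile (g c) (some b :: args) (b + 1)) b))
  | bind f g, args, b =>
    .seq (compile f args b) (retract (compile g (some b :: args) (b + 1)) b)
  | ren ρ f, args, b => compile f (ρ.map fun i => args.getD i none) b
  | loop n x s, args, b => .seq (compile n args b) (.seq (compile x args (b + 1))
      (.seq (.loop b fun _ => round (compile s (some (b + 2) :: some (b + 1) :: args) (b + 3)) b)
        (retract (clear (b + 2)) b)))

/-- A bound on the running time in terms of a bound on the length of all words. -/
def time : Code → ℕ → ℕ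
  | nil, _ => 1
  | arg _, B => 5 * B + 2
  | cons _ f, B => time f B + 1
  | cases f a g, B => time f B + time a B + (∑ c, time (g c) B) + (6 * B + 4)
  | bind f g, B => time f B + time g B + (6 * B + 3)
  | ren _ f, B => time f B
  | loop n x s, B => time n B + time x B + B * (time s B + (6 * B + 5)) + (6 * B + 5)

/-- The word in a register. -/
def val (s : Store) : Option ℕ → List Symbol
  | none => []
  | some r => s r

theorem val_update {s : Store} {b : ℕ} {l : List Symbol} {args : List (Option ℕ)}
    (ha : ∀ r, some r ∈ args → r < b) : args.map (val (update s b l)) = args.map (val s) := by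
  refine List.map_congr_left fun o ho => ?_
  rcases o with _ | r
  · rfl
  · exact update_of_ne (ha r ho).ne l s

/-- The invariant is a stack discipline: arguments lie below `b`, all registers from `b` on are
empty, and in the end only `b` has changed. A construct that binds variables stores them from `b`
upwards, runs the body above them and moves the result down. -/
theorem run_compile {c : Code} {B : ℕ} {args : List (Option ℕ)} {b : ℕ} {s : Store}
    (ha : ∀ r, some r ∈ args → r < b) (hs : ∀ r, b ≤ r → s r = [])
    (hB : ∀ v ∈ args.map (val s), v.length ≤ B) (hf : Fits B c (args.map (val s))) :
    Run (compile c args b) s (time c B) (update s b (eval c (args.map (val s)))) := by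
  induction c generalizing args b s with
  | nil => exact (Run.skip s).congr (by rw [eval, ← hs b le_rfl, update_eq_self]) le_rfl
  | arg i =>
    have e : eval (arg i) (args.map (val s)) = val s (args.getD i none) := by
      simp only [eval, List.getD_eq_getElem?_getD, List.getElem?_map]
      cases args[i]? <;> rfl
    have hl := length_eval_le hf hB
    rw [e] at hl ⊢
    rw [compile]
    rcases h : args.getD i none with _ | r
    · exact (Run.skip s).congr (by rw [val, ← hs b le_rfl, update_eq_self])
        (by rw [time]; omega)
    · rw [h] at hl
      have hr : r < b := by
        refine ha r ?_
        rw [List.getD_eq_getElem?_getD] at h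
        rcases h' : args[i]? with _ | o
        · rw [h'] at h; cases h
        · rw [h'] at h; cases h
          exact List.mem_of_getElem? h'
      refine (StackProg.run_copy (by omega) (by omega) (by omega) (hs _ le_rfl)
        (hs _ (by omega))).congr rfl ?_
      rw [time]
      rw [val] at hl
      omega
  | cons c f ih =>
    refine (Run.seq (ih ha hs hB hf.1) (.push _ _ _)).congr ?_ le_rfl
    rw [update_idem, update_self, eval]
  | cases f a g ihf iha ihg =>
    rw [Fits] at hf
    obtain ⟨hf₁, hf₂⟩ := hf
    have hl := length_eval_le hf₁ hB
    have h₁ := ihf ha hs hB hf₁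
    rw [eval, compile, time]
    rcases h : eval f (args.map (val s)) with _ | ⟨c, l⟩
    · rw [h] at h₁ hf₂
      have e : update s b [] = s := by rw [← hs b le_rfl, update_eq_self]
      rw [e] at h₁
      refine (Run.seq h₁ (.pop (t := time a B) ?_)).congr rfl (by omega)
      rw [hs b le_rfl, List.tail_nil, e]
      exact iha ha hs hB hf₂
    · rw [h] at h₁ hf₂ hl
      simp only [List.length_cons] at hl
      have ha' : ∀ r, some r ∈ some b :: args → r < b + 1 := by
        intro r hr
        rcases List.mem_cons.1 hr with hr | hr
        · cases hr; omega
        · have := ha r hr; omega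
      have hv : (some b :: args).map (val (update s b l)) = l :: args.map (val s) := by
        rw [List.map_cons, val_update ha, val, update_self]
      have hB' : ∀ v ∈ l :: args.map (val s), v.length ≤ B :=
        List.forall_mem_cons.2 ⟨by omega, hB⟩
      have hs' : ∀ r, b + 1 ≤ r → update s b l r = [] := fun r hr => by
        rw [update_of_ne (by omega)]; exact hs r (by omega)
      have h₂ := ihg c (s := update s b l) ha' hs' (by rwa [hv]) (by rwa [hv])
      have hl' := length_eval_le hf₂ hB'
      rw [hv] at h₂
      have h₃ := StackProg.run_retract h₂ hs'
      rw [update_idem, update_self] at h₃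
      refine (Run.seq h₁ (.pop (t := time (g c) B + (6 * B + 3)) ?_)).congr rfl ?_
      · rw [update_self, update_idem]
        exact h₃.mono (by omega)
      · have : time (g c) B ≤ ∑ c, time (g c) B :=
          Finset.single_le_sum (f := fun c => time (g c) B) (fun _ _ => Nat.zero_le _)
            (Finset.mem_univ c)
        omega
  | bind f g ihf ihg =>
    obtain ⟨hf₁, hf₂⟩ := hf
    have hl := length_eval_le hf₁ hB
    have h₁ := ihf ha hs hB hf₁
    rw [eval, compile, time]
    generalize eval f (args.map (val s)) = l at *
    have ha' : ∀ r, some r ∈ some b :: args → r < b + 1 := by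
      intro r hr
      rcases List.mem_cons.1 hr with hr | hr
      · cases hr; omega
      · have := ha r hr; omega
    have hv : (some b :: args).map (val (update s b l)) = l :: args.map (val s) := by
      rw [List.map_cons, val_update ha, val, update_self]
    have hB' : ∀ v ∈ l :: args.map (val s), v.length ≤ B :=
      List.forall_mem_cons.2 ⟨by omega, hB⟩
    have hs' : ∀ r, b + 1 ≤ r → update s b l r = [] := fun r hr => by
      rw [update_of_ne (by omega)]; exact hs r (by omega)
    have h₂ := ihg (s := update s b l) ha' hs' (by rwa [hv]) (by rwa [hv])
    have hl' := length_eval_le hf₂ hB'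
    rw [hv] at h₂
    have h₃ := StackProg.run_retract h₂ hs'
    rw [update_idem, update_self] at h₃
    exact (Run.seq h₁ h₃).congr rfl (by omega)
  | ren ρ f ih =>
    have e : (ρ.map fun i => args.getD i none).map (val s) =
        ρ.map fun i => (args.map (val s)).getD i [] := by
      rw [List.map_map]
      refine List.map_congr_left fun i _ => ?_
      simp only [comp, List.getD_eq_getElem?_getD, List.getElem?_map]
      cases args[i]? <;> rfl
    rw [eval, ← e]
    refine ih ?_ hs ?_ ?_
    · intro r hr
      obtain ⟨i, -, hi⟩ := List.mem_map.1 hr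
      refine ha r ?_
      rw [List.getD_eq_getElem?_getD] at hi
      rcases h' : args[i]? with _ | o
      · rw [h'] at hi; cases hi
      · rw [h'] at hi; cases hi
        exact List.mem_of_getElem? h'
    · rw [e]; exact forall_mem_ren hB ρ
    · rw [e]; exact hf
  | loop n x st ihn ihx ihs =>
    rw [Fits] at hf
    obtain ⟨hfn, hfx, hfs⟩ := hf
    have hln := length_eval_le hfn hB
    have h₁ := ihn ha hs hB hfn
    have ha' : ∀ b', b ≤ b' → ∀ r, some r ∈ args → r < b' :=
      fun b' hb r hr => lt_of_lt_of_le (ha r hr) hb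
    have h₂ := ihx (s := update s b (eval n (args.map (val s)))) (ha' (b + 1) (by omega))
      (fun r hr => by rw [update_of_ne (by omega)]; exact hs r (by omega))
      (by rwa [val_update ha]) (by rwa [val_update ha])
    rw [val_update ha] at h₂
    rw [eval]
    set e := args.map (val s)
    set v := iter (fun i v => eval st (tallies i :: v :: e)) (eval x e) with hv
    set N := (eval n e).length with hN
    have hvl : ∀ i ≤ N, (v i).length ≤ B := by
      intro i
      induction i with
      | zero => exact fun _ => length_eval_le hfx hB
      | succ i ih =>
        intro hi
        refine length_eval_le (hfs i (by omega))
          (List.forall_mem_cons.2 ⟨?_, List.forall_mem_cons.2 ⟨ih (by omega), hB⟩⟩)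
        rw [List.length_replicate]; omega
    -- The store before round `i`: `b` holds what remains of the control word, `b + 1` the current
    -- value, `b + 2` the number of the round.
    let S : List Symbol → ℕ → Store := fun l i =>
      update (update (update s b l) (b + 1) (v i)) (b + 2) (tallies i)
    have S₀ : ∀ l i, S l i b = l := fun l i => by
      simp only [S]
      rw [update_of_ne (by omega), update_of_ne (by omega), update_self]
    have S₁ : ∀ l i, S l i (b + 1) = v i := fun l i => by
      simp only [S]
      rw [update_of_ne (by omega), update_self]
    have S₂ : ∀ l i, S l i (b + 2) = tallies i := fun l i => update_self ..
    have S₃ : ∀ l i r, b + 3 ≤ r → S l i r = [] := fun l i r hr => by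
      simp only [S]
      rw [update_of_ne (by omega), update_of_ne (by omega), update_of_ne (by omega)]
      exact hs r (by omega)
    have rounds : ∀ l : List Symbol, ∀ i, i + l.length = N →
        Run (.loop b fun _ => round (compile st (some (b + 2) :: some (b + 1) :: args) (b + 3)) b)
          (S l i) (l.length * (time st B + (6 * B + 5)) + 1) (S [] N) := by
      intro l
      induction l with
      | nil =>
        intro i hi
        rw [List.length_nil, add_zero] at hi
        exact (Run.loop_nil (S₀ _ _)).congr (by rw [hi]) (by simp)
      | cons c l ih =>
        intro i hi
        rw [List.length_cons] at hi
        have he : (some (b + 2) :: some (b + 1) :: args).map (val (S l i)) =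
            tallies i :: v i :: e := by
          rw [List.map_cons, List.map_cons, val, S₂, val, S₁]
          simp only [S]
          rw [val_update (ha' _ (by omega)), val_update (ha' _ (by omega)), val_update ha]
        have h := ihs (args := some (b + 2) :: some (b + 1) :: args) (b := b + 3) (s := S l i)
          (by
            intro r hr
            rcases List.mem_cons.1 hr with hr | hr
            · cases hr; omega
            rcases List.mem_cons.1 hr with hr | hr
            · cases hr; omega
            · have := ha r hr; omega)
          (S₃ l i) (by
            rw [he]
            exact List.forall_mem_cons.2 ⟨by rw [List.length_replicate]; omega,
              List.forall_mem_cons.2 ⟨hvl i (by omega), hB⟩⟩) (by rw [he]; exact hfs i (by omega))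
        rw [he] at h
        have h' := StackProg.run_round (w := v (i + 1)) h (S₃ l i)
        have e₁ : update (S (c :: l) i) b l = S l i := by
          funext k
          simp only [S, update_apply]
          split_ifs <;> first | rfl | omega
        have e₂ : update (update (S l i) (b + 1) (v (i + 1))) (b + 2)
            (.tally :: S l i (b + 2)) = S l (i + 1) := by
          rw [S₂]
          funext k
          simp only [S, update_apply]
          split_ifs <;> rfl
        rw [e₂, S₁] at h'
        have := hvl i (by omega)
        have := hvl (i + 1) (by omega)
        refine (Run.loop_cons (S₀ _ _) (by rw [e₁]; exact h') (ih (i + 1) (by omega))).congr rfl ?_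
        rw [List.length_cons, add_mul, one_mul]
        omega
    -- Round number zero is the empty word, which register `b + 2` already holds.
    have e₀ : update (update s b (eval n e)) (b + 1) (eval x e) = S (eval n e) 0 := by
      simp only [S]
      refine (update_eq_self_iff.2 ?_).symm
      rw [update_of_ne (by omega), update_of_ne (by omega)]
      exact (hs _ (by omega)).symm
    rw [e₀] at h₂
    have h₃ := StackProg.run_clear (b + 2) (S [] N)
    have e₃ : update (S [] N) (b + 2) [] = update s (b + 1) (v N) := by
      simp only [S]
      rw [update_idem, ← hs b le_rfl, update_eq_self, update_eq_self_iff.2]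
      rw [update_of_ne (by omega)]
      exact ((hs _ le_rfl).trans (hs _ (by omega)).symm)
    have h₄ := StackProg.run_retract (h₃.congr e₃ le_rfl) fun r hr => hs r (by omega)
    refine (Run.seq h₁ (Run.seq h₂ (Run.seq (rounds _ 0 (Nat.zero_add _)) h₄))).congr rfl ?_
    have := hvl N le_rfl
    have : (eval n e).length * (time st B + (6 * B + 5)) ≤ B * (time st B + (6 * B + 5)) :=
      Nat.mul_le_mul_right _ hln
    rw [S₂, hs b le_rfl, List.length_replicate, List.length_nil, time]
    omega

/-- Functions below a power of their argument. -/
def PolyBounded (f : ℕ → ℕ) : Prop := ∃ k, ∀ B, f B ≤ (B + 2) ^ k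

theorem PolyBounded.const (a : ℕ) : PolyBounded fun _ => a :=
  ⟨a, fun B => Nat.lt_two_pow_self.le.trans (Nat.pow_le_pow_left (by omega) a)⟩

theorem PolyBounded.id : PolyBounded fun B => B := ⟨1, fun B => by simp⟩

theorem PolyBounded.mul {f g : ℕ → ℕ} (hf : PolyBounded f) (hg : PolyBounded g) :
    PolyBounded fun B => f B * g B :=
  let ⟨k, hk⟩ := hf
  let ⟨l, hl⟩ := hg
  ⟨k + l, fun B => (Nat.mul_le_mul (hk B) (hl B)).trans (pow_add _ _ _).ge⟩

theorem PolyBounded.add {f g : ℕ → ℕ} (hf : PolyBounded f) (hg : PolyBounded g) :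
    PolyBounded fun B => f B + g B := by
  obtain ⟨k, hk⟩ := hf
  obtain ⟨l, hl⟩ := hg
  refine ⟨k + l + 1, fun B => (Nat.add_le_add (hk B) (hl B)).trans ?_⟩
  have h₁ : (B + 2) ^ k ≤ (B + 2) ^ (k + l) := Nat.pow_le_pow_right (by omega) (by omega)
  have h₂ : (B + 2) ^ l ≤ (B + 2) ^ (k + l) := Nat.pow_le_pow_right (by omega) (by omega)
  calc _ ≤ (B + 2) ^ (k + l) * 2 := by omega
    _ ≤ (B + 2) ^ (k + l + 1) := by
        rw [pow_succ]; exact Nat.mul_le_mul_left _ (by omega)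

theorem PolyBounded.sum {ι : Type} {f : ι → ℕ → ℕ} (hf : ∀ i, PolyBounded (f i))
    (s : Finset ι) : PolyBounded fun B => ∑ i ∈ s, f i B := by
  classical
  induction s using Finset.induction_on with
  | empty => exact .const 0
  | insert i s hi ih => simpa only [Finset.sum_insert hi] using (hf i).add ih

/-- The only iteration is `loop`, with at most `B` rounds, so the degree depends only on the fixed
code. -/
theorem polyBounded_time (c : Code) : PolyBounded (time c) := by
  induction c with
  | nil => exact .const 1
  | arg i => exact ((PolyBounded.const 5).mul .id).add (.const 2)
  | cons c f ih => exact ih.add (.const 1)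
  | cases f a g ihf iha ihg =>
    exact ((ihf.add iha).add (.sum ihg _)).add (((PolyBounded.const 6).mul .id).add (.const 4))
  | bind f g ihf ihg => exact (ihf.add ihg).add (((PolyBounded.const 6).mul .id).add (.const 3))
  | ren ρ f ih => exact ih
  | loop n x s ihn ihx ihs =>
    exact ((ihn.add ihx).add (PolyBounded.id.mul
      (ihs.add (((PolyBounded.const 6).mul .id).add (.const 5))))).add
        (((PolyBounded.const 6).mul .id).add (.const 5))

end Code

/-- Raising a double exponential to a fixed power multiplies the upper exponent by a constant, which
costs only a constant summand in the innermost one. -/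
theorem add_two_le_tower (n k : ℕ) : (2 ^ 2 ^ n + 2) ^ k ≤ 2 ^ 2 ^ (n + k + 1) := by
  have h₁ : 1 ≤ 2 ^ n := Nat.one_le_two_pow
  have h₂ : 2 ≤ 2 ^ 2 ^ n := le_trans (by norm_num) (Nat.pow_le_pow_right (by omega) h₁)
  calc (2 ^ 2 ^ n + 2) ^ k ≤ (2 ^ 2 ^ n * 2 ^ 2 ^ n) ^ k := Nat.pow_le_pow_left (by nlinarith) k
    _ = 2 ^ (2 ^ n * 2 * k) := by rw [← pow_add, ← pow_mul]; ring_nf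
    _ ≤ 2 ^ 2 ^ (n + k + 1) := Nat.pow_le_pow_right (by omega) (by
        rw [pow_succ, pow_add, mul_assoc, mul_assoc, mul_comm 2 k]
        exact Nat.mul_le_mul_left _ (Nat.mul_le_mul_right _ Nat.lt_two_pow_self.le))

/-- A language is in `2EXPTIME` if a functional program decides it that builds only words of at
most doubly exponential length. -/
theorem mem_twoEXPTIME {L : Language Symbol} (c : Code) (k : ℕ)
    (hc : ∀ w, c.eval [w] = open Classical in if w ∈ L then [Symbol.tally] else [])
    (hf : ∀ w : List Symbol, Code.Fits (2 ^ 2 ^ (w.length + k)) c [w]) :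
    L ∈ TwoEXPTIME Symbol := by
  classical
  -- The summand `2 * B + 2` pays for emptying the input register `0` and for the last step of the
  -- machine.
  obtain ⟨l, hl⟩ := c.polyBounded_time.add (((Code.PolyBounded.const 2).mul .id).add (.const 2))
  refine ⟨Polynomial.X + Polynomial.C (k + l + 1), ⟨⟨StackProg.machine
    (.seq (c.compile [some 0] 1) (StackProg.clear 0)), .refl _, .refl _⟩,
    fun n => 2 ^ 2 ^ (n + (k + l + 1)), fun w => Classical.choice ?_⟩, fun n => ?_⟩
  · have hw : w.length ≤ 2 ^ 2 ^ (w.length + k) :=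
      (Nat.lt_two_pow_self.trans (Nat.pow_lt_pow_right (by omega)
        ((Nat.lt_two_pow_self (n := w.length)).trans_le
          (Nat.pow_le_pow_right (by omega) (Nat.le_add_right _ k))))).le
    have h := Code.run_compile (c := c) (args := [some 0]) (b := 1)
      (s := Function.update (fun _ => []) 0 w) (by simp)
      (fun r hr => Function.update_of_ne (by omega) _ _) (by simpa [Code.val] using hw)
      (by simpa [Code.val] using hf w)
    have h' := (StackProg.Run.seq h (StackProg.run_clear 0 _)).congr
      (s₂ := Function.update (fun _ => []) 1
        (if decide (w ∈ L) = true then [Symbol.tally] else [])) (by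
        funext k
        simp only [List.map_cons, List.map_nil, Code.val, Function.update_self, hc,
          Function.update_apply, decide_eq_true_eq]
        split_ifs <;> simp_all) le_rfl
    obtain ⟨h''⟩ := StackProg.machine_outputs h'
    have e : List.map (Equiv.refl Symbol).invFun (id w) = w := List.map_id w
    have ht := (hl (2 ^ 2 ^ (w.length + k))).trans (add_two_le_tower _ l)
    rw [Function.update_of_ne (by omega), Function.update_self] at h''
    -- Stated for every `x = w`, because the machine receives `w` as its image under the identity
    -- encoding of the alphabet.
    have key : ∀ x, x = w → Nonempty (Turing.TM2OutputsInTime (StackProg.machine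
        (.seq (c.compile [some 0] 1) (StackProg.clear 0))) x (some [decide (w ∈ L)])
          (2 ^ 2 ^ (w.length + (k + l + 1)))) := by
      rintro x rfl
      refine ⟨⟨h''.1, h''.2.trans (le_trans ?_ (ht.trans ?_))⟩⟩
      · have : c.time (2 ^ 2 ^ (x.length + k)) + (2 * x.length + 1) + 1 ≤
          c.time (2 ^ 2 ^ (x.length + k)) + (2 * 2 ^ 2 ^ (x.length + k) + 2) := by omega
        exact this
      · rw [← add_assoc, ← add_assoc]
    exact key _ e
  · simp

end AdaptiveSync

/-! ### A calculus of functions computable with polynomially long words. -/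

namespace AdaptiveSync

/-! ### Polynomially feasible functions -/

/-- Types whose elements are represented by words. -/
class Rep (α : Type) where
  rep : α → List Symbol

/-- Types whose elements are represented by a fixed number of words. -/
class Ctx (Γ : Type) where
  env : Γ → List (List Symbol)
  len : ℕ
  length_env : ∀ a, (env a).length = len

open AdaptiveSync.Rep Ctx

instance : Rep ℕ := ⟨tallies⟩

instance : Rep (List Symbol) := ⟨id⟩

open Classical in
noncomputable instance : Rep Prop := ⟨fun p => if p then [Symbol.tally] else []⟩

instance : Ctx Unit := ⟨fun _ => [], 0, fun _ => rfl⟩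

instance {Γ α : Type} [Ctx Γ] [Rep α] : Ctx (Γ × α) :=
  ⟨fun p => rep p.2 :: env p.1, len Γ + 1, fun p => congrArg (· + 1) (length_env p.1)⟩

theorem rep_true : rep True = [Symbol.tally] := if_pos trivial

theorem rep_false : rep False = [] := if_neg id

theorem rep_prop_length_le (p : Prop) : (rep p).length ≤ 1 := by
  by_cases h : p
  · rw [eq_true h, rep_true]; rfl
  · rw [eq_false h, rep_false]; exact Nat.zero_le 1

/-- The words that represent `a` have length at most `A`. -/
def EnvLE {Γ : Type} [Ctx Γ] (A : ℕ) (a : Γ) : Prop := ∀ v ∈ env a, v.length ≤ A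

theorem envLE_prod {Γ α : Type} [Ctx Γ] [Rep α] {A : ℕ} {p : Γ × α} :
    EnvLE A p ↔ (rep p.2).length ≤ A ∧ EnvLE A p.1 := List.forall_mem_cons

theorem EnvLE.mono {Γ : Type} [Ctx Γ] {A A' : ℕ} {a : Γ} (h : EnvLE A a) (hA : A ≤ A') :
    EnvLE A' a := fun v hv => (h v hv).trans hA

/-- Functions that are computed by a functional program which builds only words whose length is
polynomial in the length of the arguments. -/
def Feas {Γ α : Type} [Ctx Γ] [Rep α] (f : Γ → α) : Prop :=
  ∃ (c : Code) (k : ℕ), ∀ (A : ℕ) (a : Γ), EnvLE A a →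
    c.eval (env a) = rep (f a) ∧ c.Fits ((A + 2) ^ k) (env a)

/-- Bounds of the form `(A + 2) ^ k` are closed under substitution; the base `A + 2` lets a power
absorb additive constants. -/
theorem add_two_pow_add_two_pow_le (A k l : ℕ) :
    ((A + 2) ^ k + 2) ^ l ≤ (A + 2) ^ ((k + 2) * l) := by
  rw [pow_mul]
  refine Nat.pow_le_pow_left ?_ l
  have : 1 ≤ (A + 2) ^ k := Nat.one_le_pow _ _ (by omega)
  rw [pow_add]
  have : 4 ≤ (A + 2) ^ 2 := by nlinarith [Nat.zero_le A]
  nlinarith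

theorem add_two_pow_le (A : ℕ) {k l : ℕ} (h : k ≤ l) : (A + 2) ^ k ≤ (A + 2) ^ l :=
  Nat.pow_le_pow_right (by omega) h

namespace Feas

variable {Γ α β γ δ : Type} [Ctx Γ] [Rep α] [Rep β] [Rep γ] [Rep δ]

/-- The exponent is raised by one to cover programs that merely return an argument, where `k` may be
zero. -/
theorem bounded {f : Γ → α} (h : Feas f) :
    ∃ k, ∀ (A : ℕ) (a : Γ), EnvLE A a → (rep (f a)).length ≤ (A + 2) ^ k := by
  obtain ⟨c, k, h⟩ := h
  refine ⟨k + 1, fun A a ha => ?_⟩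
  rw [← (h A a ha).1]
  refine Code.length_eval_le ((h A a ha).2.mono (add_two_pow_le A (by omega)))
    fun v hv => (ha v hv).trans ?_
  exact (by omega : A ≤ A + 2).trans (Nat.le_self_pow (by omega) _)

theorem bind {f : Γ → α} {g : Γ × α → β} (hf : Feas f) (hg : Feas g) :
    Feas fun a => g (a, f a) := by
  obtain ⟨k', hk'⟩ := hf.bounded
  obtain ⟨c, k, h⟩ := hf
  obtain ⟨d, l, h'⟩ := hg
  refine ⟨.bind c d, k + (k' + 1 + 2) * l, fun A a ha => ?_⟩
  obtain ⟨h₁, h₂⟩ := h A a ha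
  have hA : A ≤ (A + 2) ^ (k' + 1) :=
    (by omega : A ≤ A + 2).trans (Nat.le_self_pow (by omega) _)
  obtain ⟨h₃, h₄⟩ := h' ((A + 2) ^ (k' + 1)) (a, f a)
    (envLE_prod.2 ⟨(hk' A a ha).trans (add_two_pow_le A (by omega)), ha.mono hA⟩)
  change d.eval (rep (f a) :: env a) = _ at h₃
  change d.Fits _ (rep (f a) :: env a) at h₄
  rw [← h₁] at h₃ h₄
  exact ⟨h₃, h₂.mono (add_two_pow_le A (by omega)),
    h₄.mono ((add_two_pow_add_two_pow_le A _ _).trans (add_two_pow_le A (by omega)))⟩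

theorem ren {Γ' : Type} [Ctx Γ'] {f : Γ → α} (hf : Feas f) (σ : Γ' → Γ) (ρ : List ℕ)
    (h : ∀ a, (ρ.map fun i => (env a).getD i []) = env (σ a)) : Feas fun a => f (σ a) := by
  obtain ⟨c, k, hc⟩ := hf
  refine ⟨.ren ρ c, k, fun A a ha => ?_⟩
  rw [Code.eval, Code.Fits, h]
  refine hc A (σ a) ?_
  rw [EnvLE, ← h]
  exact Code.forall_mem_ren ha ρ

theorem wk {f : Γ → β} (hf : Feas f) : Feas fun p : Γ × α => f p.1 := by
  refine hf.ren _ ((List.range (len Γ)).map (· + 1)) fun p => ?_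
  rw [List.map_map, ← length_env p.1]
  refine List.ext_getElem (by simp) fun i h₁ h₂ => ?_
  simp [env, h₂]

theorem snd : Feas fun p : Γ × α => p.2 :=
  ⟨.arg 0, 0, fun _ _ _ => ⟨rfl, trivial⟩⟩

/-- Reduces a binary operation to a context with just two variables, in which size bounds can be
read off from the two arguments. -/
theorem comp₂ {h : α → β → γ} (hh : Feas fun p : (Unit × α) × β => h p.1.2 p.2)
    {f : Γ → α} {g : Γ → β} (hf : Feas f) (hg : Feas g) : Feas fun a => h (f a) (g a) :=
  hf.bind (g := fun p => h p.2 (g p.1)) (hg.wk.bind (g := fun q => h q.1.2 q.2)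
    (hh.ren (fun p : (Γ × α) × β => (((), p.1.2), p.2)) [0, 1] fun _ => rfl))

theorem nil : Feas fun _ : Γ => ([] : List Symbol) :=
  ⟨.nil, 0, fun _ _ _ => ⟨rfl, trivial⟩⟩

theorem cons (c : Symbol) {f : Γ → List Symbol} (hf : Feas f) : Feas fun a => c :: f a := by
  obtain ⟨k', hk'⟩ := hf.bounded
  obtain ⟨d, k, h⟩ := hf
  refine ⟨.cons c d, k + k' + 1, fun A a ha => ?_⟩
  obtain ⟨h₁, h₂⟩ := h A a ha
  refine ⟨by rw [Code.eval, h₁]; rfl, h₂.mono (add_two_pow_le A (by omega)), ?_⟩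
  rw [h₁]
  have h₃ := hk' A a ha
  have h₄ : (A + 2) ^ k' ≤ (A + 2) ^ (k + k') := add_two_pow_le A (by omega)
  have h₅ : 1 ≤ (A + 2) ^ (k + k') := Nat.one_le_pow _ _ (by omega)
  rw [pow_succ]
  nlinarith

/-- Feasibility sees only the representing words. So values may be rewritten, and a number may be
exchanged for its tally word. -/
theorem of_rep {f : Γ → α} {g : Γ → β} (hf : Feas f) (h : ∀ a, rep (f a) = rep (g a)) :
    Feas g := by
  obtain ⟨c, k, hc⟩ := hf
  exact ⟨c, k, fun A a ha => h a ▸ hc A a ha⟩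

theorem tallies {f : Γ → ℕ} (hf : Feas f) : Feas fun a => AdaptiveSync.tallies (f a) :=
  hf.of_rep fun _ => rfl

theorem zero : Feas fun _ : Γ => 0 := nil.of_rep fun _ => rfl

theorem succ {f : Γ → ℕ} (hf : Feas f) : Feas fun a => f a + 1 :=
  (hf.tallies.cons Symbol.tally).of_rep fun _ => rfl

theorem const (n : ℕ) : Feas fun _ : Γ => n := by
  induction n with
  | zero => exact zero
  | succ n ih => exact ih.succ

theorem true : Feas fun _ : Γ => True := (nil.cons Symbol.tally).of_rep fun _ => rep_true.symm

theorem false : Feas fun _ : Γ => False := nil.of_rep fun _ => rep_false.symm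

end Feas

/-- Case distinction on a word. -/
def listCase {α : Type} (a : α) (b : Symbol → List Symbol → α) : List Symbol → α
  | [] => a
  | c :: l => b c l

/-- Whether a word starts with a symbol that satisfies `q`. -/
def Starts (q : Symbol → Bool) (l : List Symbol) : Prop :=
  listCase False (fun c _ => q c = true) l

/-- Case distinction on a number. -/
def natCase {α : Type} (a : α) (b : ℕ → α) : ℕ → α
  | 0 => a
  | n + 1 => b n

namespace Feas

variable {Γ α β γ δ : Type} [Ctx Γ] [Rep α] [Rep β] [Rep γ] [Rep δ]

theorem listCase {f : Γ → List Symbol} {a : Γ → α} {b : Symbol → Γ → List Symbol → α}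
    (hf : Feas f) (ha : Feas a) (hb : ∀ c, Feas fun p : Γ × List Symbol => b c p.1 p.2) :
    Feas fun x => listCase (a x) (fun c l => b c x l) (f x) := by
  obtain ⟨k', hk'⟩ := hf.bounded
  obtain ⟨c, k, hc⟩ := hf
  obtain ⟨ca, ka, hca⟩ := ha
  choose cb kb hcb using hb
  -- The sum serves as one exponent for the branches of all symbols.
  have hkb : ∀ s, kb s ≤ ∑ s, kb s := fun s =>
    Finset.single_le_sum (f := kb) (fun _ _ => Nat.zero_le _) (Finset.mem_univ s)
  refine ⟨.cases c ca cb, k + ka + (k' + 1 + 2) * ∑ s, kb s, fun A x hx => ?_⟩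
  obtain ⟨h₁, h₂⟩ := hc A x hx
  rw [Code.eval, Code.Fits, h₁]
  have h₃ := hk' A x hx
  change (f x).length ≤ _ at h₃
  change (match f x with | [] => _ | c :: l => _) = _ ∧
    (c.Fits _ _ ∧ match f x with | [] => _ | c :: l => _)
  dsimp only
  rcases h : f x with _ | ⟨s, l⟩
  · obtain ⟨h₄, h₅⟩ := hca A x hx
    exact ⟨h₄, h₂.mono (add_two_pow_le A (by omega)), h₅.mono (add_two_pow_le A (by omega))⟩
  · rw [h, List.length_cons] at h₃
    have hA : A ≤ (A + 2) ^ (k' + 1) :=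
      (by omega : A ≤ A + 2).trans (Nat.le_self_pow (by omega) _)
    obtain ⟨h₄, h₅⟩ := hcb s ((A + 2) ^ (k' + 1)) (x, l) (envLE_prod.2
      ⟨(Nat.le_of_succ_le h₃).trans (add_two_pow_le A (by omega)), hx.mono hA⟩)
    refine ⟨h₄, h₂.mono (add_two_pow_le A (by omega)), h₅.mono
      ((add_two_pow_add_two_pow_le A _ _).trans (add_two_pow_le A ?_))⟩
    have := Nat.mul_le_mul_left (k' + 1 + 2) (hkb s)
    omega

theorem ite {p : Γ → Prop} [∀ a, Decidable (p a)] {f g : Γ → α} (hp : Feas p) (hf : Feas f)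
    (hg : Feas g) : Feas fun a => if p a then f a else g a := by
  have h : Feas fun a => rep (p a) := hp.of_rep fun _ => rfl
  refine (h.listCase hg (b := fun _ a _ => f a) fun _ => hf.wk).of_rep fun a => ?_
  by_cases ha : p a
  · rw [if_pos ha, eq_true ha, rep_true]; rfl
  · rw [if_neg ha, eq_false ha, rep_false]; rfl

/-- The bound `hb` on the iterates is essential: iterating a feasible step such as doubling can
produce exponentially long words. -/
theorem iter {n : Γ → ℕ} {x : Γ → α} {s : Γ → ℕ → α → α} (hn : Feas n) (hx : Feas x)
    (hs : Feas fun p : (Γ × α) × ℕ => s p.1.1 p.2 p.1.2)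
    (hb : ∃ k, ∀ (A : ℕ) (a : Γ), EnvLE A a → ∀ i ≤ n a,
      (rep (iter (s a) (x a) i)).length ≤ (A + 2) ^ k) :
    Feas fun a => iter (s a) (x a) (n a) := by
  obtain ⟨kb, hb⟩ := hb
  obtain ⟨k', hk'⟩ := hn.bounded
  obtain ⟨cn, kn, hcn⟩ := hn
  obtain ⟨cx, kx, hcx⟩ := hx
  obtain ⟨cs, ks, hcs⟩ := hs
  refine ⟨.loop cn cx cs, kn + kx + (k' + kb + 1 + 2) * ks, fun A a ha => ?_⟩
  obtain ⟨h₁, h₂⟩ := hcn A a ha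
  obtain ⟨h₃, h₄⟩ := hcx A a ha
  have hA : A ≤ (A + 2) ^ (k' + kb + 1) :=
    (by omega : A ≤ A + 2).trans (Nat.le_self_pow (by omega) _)
  have hna : (rep (n a)).length = n a := List.length_replicate ..
  have hn' := hk' A a ha
  rw [hna] at hn'
  have hs' : ∀ i ≤ n a, ∀ v, v = AdaptiveSync.iter (s a) (x a) i →
      cs.eval (AdaptiveSync.tallies i :: rep v :: env a) = rep (s a i v) ∧
      cs.Fits ((A + 2) ^ ((k' + kb + 1 + 2) * ks))
        (AdaptiveSync.tallies i :: rep v :: env a) := by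
    rintro i hi v rfl
    obtain ⟨h₅, h₆⟩ := hcs ((A + 2) ^ (k' + kb + 1)) ((a, AdaptiveSync.iter (s a) (x a) i), i)
      (envLE_prod.2 ⟨((List.length_replicate (n := i)).le.trans (hi.trans hn')).trans
        (add_two_pow_le A (by omega)), envLE_prod.2
          ⟨(hb A a ha i hi).trans (add_two_pow_le A (by omega)), ha.mono hA⟩⟩)
    exact ⟨h₅, h₆.mono (add_two_pow_add_two_pow_le A _ _)⟩
  have key : ∀ i ≤ n a, AdaptiveSync.iter
      (fun i v => cs.eval (AdaptiveSync.tallies i :: v :: env a)) (cx.eval (env a)) i =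
        rep (AdaptiveSync.iter (s a) (x a) i) := by
    intro i
    induction i with
    | zero => exact fun _ => h₃
    | succ i ih =>
      intro hi
      rw [AdaptiveSync.iter, ih (by omega)]
      exact (hs' i (by omega) _ rfl).1
  rw [Code.eval, Code.Fits, h₁, hna]
  refine ⟨key _ le_rfl, h₂.mono (add_two_pow_le A (by omega)),
    h₄.mono (add_two_pow_le A (by omega)), fun i hi => ?_⟩
  rw [key i hi.le]
  exact (hs' i hi.le _ rfl).2.mono (add_two_pow_le A (by omega))

theorem iter_of_le {n : Γ → ℕ} {x : Γ → α} {s : Γ → ℕ → α → α} {g : Γ → β} (hn : Feas n)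
    (hx : Feas x) (hs : Feas fun p : (Γ × α) × ℕ => s p.1.1 p.2 p.1.2) (hg : Feas g)
    (h : ∀ a, ∀ i ≤ n a, (rep (AdaptiveSync.iter (s a) (x a) i)).length ≤ (rep (g a)).length) :
    Feas fun a => AdaptiveSync.iter (s a) (x a) (n a) :=
  let ⟨k, hk⟩ := hg.bounded
  hn.iter hx hs ⟨k, fun A a ha i hi => (h a i hi).trans (hk A a ha)⟩

theorem iter_prop {n : Γ → ℕ} {x : Γ → Prop} {s : Γ → ℕ → Prop → Prop} (hn : Feas n)
    (hx : Feas x) (hs : Feas fun p : (Γ × Prop) × ℕ => s p.1.1 p.2 p.1.2) :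
    Feas fun a => AdaptiveSync.iter (s a) (x a) (n a) :=
  hn.iter_of_le hx hs true fun _ _ _ => (rep_prop_length_le _).trans (by rw [rep_true]; rfl)

theorem length {f : Γ → List Symbol} (hf : Feas f) : Feas fun a => (f a).length := by
  obtain ⟨k', hk'⟩ := hf.bounded
  obtain ⟨c, k, hc⟩ := hf
  refine ⟨.loop c .nil (.cons .tally (.arg 1)), k + k', fun A a ha => ?_⟩
  obtain ⟨h₁, h₂⟩ := hc A a ha
  have key : ∀ i, AdaptiveSync.iter (fun i v => (Code.cons .tally (.arg 1)).eval
      (AdaptiveSync.tallies i :: v :: env a)) (Code.nil.eval (env a)) i =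
        AdaptiveSync.tallies i := by
    intro i
    induction i with
    | zero => rfl
    | succ i ih => rw [AdaptiveSync.iter, ih]; rfl
  rw [Code.eval, Code.Fits, h₁]
  have h₃ := hk' A a ha
  refine ⟨key _, h₂.mono (add_two_pow_le A (by omega)), trivial, fun i hi => ⟨trivial, ?_⟩⟩
  rw [key]
  refine le_trans ?_ (h₃.trans (add_two_pow_le A (by omega)))
  exact (congrArg (· + 1) (List.length_replicate (n := i))).le.trans hi

theorem under {f : Γ × β → α} (hf : Feas f) : Feas fun p : (Γ × γ) × β => f (p.1.1, p.2) := by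
  refine hf.ren _ (0 :: (List.range (len Γ)).map (· + 2)) fun p => ?_
  rw [List.map_cons, List.map_map, ← length_env p.1.1]
  refine congrArg (rep p.2 :: ·) (List.ext_getElem (by simp) fun i h₁ h₂ => ?_)
  simp [env, h₂]

theorem natCase {f : Γ → ℕ} {a : Γ → α} {b : Γ → ℕ → α}
    (hf : Feas f) (ha : Feas a) (hb : Feas fun p : Γ × ℕ => b p.1 p.2) :
    Feas fun x => natCase (a x) (b x) (f x) := by
  have hb' : Feas fun p : Γ × List Symbol => b p.1 p.2.length := snd.length.bind hb.under
  refine (hf.tallies.listCase ha (b := fun _ x l => b x l.length) fun _ => hb').of_rep fun x => ?_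
  cases h : f x <;> simp [AdaptiveSync.listCase, AdaptiveSync.natCase, List.replicate_succ]

theorem iterate {n : Γ → ℕ} {x : Γ → α} {s : Γ → α → α} {g : Γ → β} (hn : Feas n) (hx : Feas x)
    (hs : Feas fun p : Γ × α => s p.1 p.2) (hg : Feas g)
    (h : ∀ a, ∀ i ≤ n a, (rep ((s a)^[i] (x a))).length ≤ (rep (g a)).length) :
    Feas fun a => (s a)^[n a] (x a) := by
  have e : ∀ a i, AdaptiveSync.iter (fun _ => s a) (x a) i = (s a)^[i] (x a) := by
    intro a i
    induction i with
    | zero => rfl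
    | succ i ih => rw [AdaptiveSync.iter, ih, Function.iterate_succ_apply']
  refine (hn.iter_of_le hx (s := fun a _ => s a) hs.wk hg fun a i hi => ?_).of_rep
    fun a => by rw [e]
  rw [e]
  exact h a i hi

/-! ### Logic -/

theorem not {p : Γ → Prop} (hp : Feas p) : Feas fun a => ¬p a := by
  classical
  refine (hp.ite false true).of_rep fun a => ?_
  by_cases h : p a <;> simp [h]

theorem and {p q : Γ → Prop} (hp : Feas p) (hq : Feas q) : Feas fun a => p a ∧ q a := by
  classical
  refine (hp.ite hq false).of_rep fun a => ?_
  by_cases h : p a <;> simp [h]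

theorem or {p q : Γ → Prop} (hp : Feas p) (hq : Feas q) : Feas fun a => p a ∨ q a := by
  classical
  refine (hp.ite true hq).of_rep fun a => ?_
  by_cases h : p a <;> simp [h]

theorem imp {p q : Γ → Prop} (hp : Feas p) (hq : Feas q) : Feas fun a => p a → q a := by
  classical
  refine (hp.ite hq true).of_rep fun a => ?_
  by_cases h : p a <;> simp [h]

theorem iff {p q : Γ → Prop} (hp : Feas p) (hq : Feas q) : Feas fun a => (p a ↔ q a) := by
  classical
  refine (hp.ite hq hq.not).of_rep fun a => ?_
  by_cases h : p a <;> simp [h]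

/-- A loop accumulates the disjunction; truth values are words of length at most one, so no size
condition arises. -/
theorem exists_lt {n : Γ → ℕ} {p : Γ → ℕ → Prop} (hn : Feas n)
    (hp : Feas fun q : Γ × ℕ => p q.1 q.2) : Feas fun a => ∃ i < n a, p a i := by
  refine (hn.iter_prop false (s := fun a i v => v ∨ p a i) (snd.wk.or hp.under)).of_rep fun a => ?_
  congr 1
  generalize n a = m
  induction m with
  | zero => simp [AdaptiveSync.iter]
  | succ m ih =>
    rw [AdaptiveSync.iter, ih]
    simp only [Nat.lt_succ_iff_lt_or_eq, or_and_right, exists_or, exists_eq_left]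

theorem forall_lt {n : Γ → ℕ} {p : Γ → ℕ → Prop} (hn : Feas n)
    (hp : Feas fun q : Γ × ℕ => p q.1 q.2) : Feas fun a => ∀ i < n a, p a i :=
  (hn.exists_lt (p := fun a i => ¬p a i) hp.not).not.of_rep fun a => by simp

/-! ### Arithmetic -/

theorem pred {f : Γ → ℕ} (hf : Feas f) : Feas fun a => f a - 1 :=
  (hf.natCase zero (b := fun _ n => n) snd).of_rep fun a => by cases f a <;> rfl

theorem eq_zero {f : Γ → ℕ} (hf : Feas f) : Feas fun a => f a = 0 :=
  (hf.natCase true (b := fun _ _ => False) false).of_rep fun a => by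
    cases f a <;> simp [AdaptiveSync.natCase]

theorem rep_nat_length (n : ℕ) : (rep n).length = n := List.length_replicate ..

theorem add {f g : Γ → ℕ} (hf : Feas f) (hg : Feas g) : Feas fun a => f a + g a := by
  refine comp₂ (h := fun x y => x + y) ?_ hf hg
  have e : ∀ x i : ℕ, AdaptiveSync.iter (fun _ v => v + 1) x i = x + i := by
    intro x i
    induction i with
    | zero => rfl
    | succ i ih => rw [AdaptiveSync.iter, ih, add_assoc]
  refine (iter (s := fun _ _ v => v + 1) (n := fun p : (Unit × ℕ) × ℕ => p.2)
    (x := fun p => p.1.2) snd snd.wk snd.wk.succ ⟨2, fun A a ha i hi => ?_⟩).of_rep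
      fun a => by rw [e]
  rw [e, rep_nat_length]
  obtain ⟨h₁, h₂⟩ := envLE_prod.1 ha
  obtain ⟨h₃, -⟩ := envLE_prod.1 h₂
  rw [rep_nat_length] at h₁ h₃
  nlinarith

theorem mul {f g : Γ → ℕ} (hf : Feas f) (hg : Feas g) : Feas fun a => f a * g a := by
  refine comp₂ (h := fun x y => x * y) ?_ hf hg
  have e : ∀ x i : ℕ, AdaptiveSync.iter (fun _ v => v + x) 0 i = x * i := by
    intro x i
    induction i with
    | zero => rfl
    | succ i ih => rw [AdaptiveSync.iter, ih, Nat.mul_succ]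
  refine (iter (s := fun p _ v => v + p.1.2) (n := fun p : (Unit × ℕ) × ℕ => p.2)
    (x := fun p => 0) snd zero (snd.wk.add snd.wk.wk.wk) ⟨2, fun A a ha i hi => ?_⟩).of_rep
      fun a => by rw [e]
  rw [e, rep_nat_length]
  obtain ⟨h₁, h₂⟩ := envLE_prod.1 ha
  obtain ⟨h₃, -⟩ := envLE_prod.1 h₂
  rw [rep_nat_length] at h₁ h₃
  nlinarith

theorem sub {f g : Γ → ℕ} (hf : Feas f) (hg : Feas g) : Feas fun a => f a - g a := by
  have e : ∀ x i : ℕ, (fun v => v - 1)^[i] x = x - i := by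
    intro x i
    induction i with
    | zero => rfl
    | succ i ih => rw [Function.iterate_succ_apply', ih]; omega
  refine (iterate hg hf (s := fun _ v => v - 1) snd.pred hf fun a i _ => ?_).of_rep
    fun a => by rw [e]
  rw [e, rep_nat_length, rep_nat_length]
  omega

theorem le {f g : Γ → ℕ} (hf : Feas f) (hg : Feas g) : Feas fun a => f a ≤ g a :=
  (hf.sub hg).eq_zero.of_rep fun a => by rw [Nat.sub_eq_zero_iff_le]

theorem lt {f g : Γ → ℕ} (hf : Feas f) (hg : Feas g) : Feas fun a => f a < g a :=
  hf.succ.le hg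

theorem eq {f g : Γ → ℕ} (hf : Feas f) (hg : Feas g) : Feas fun a => f a = g a :=
  ((hf.le hg).and (hg.le hf)).of_rep fun a => by rw [← le_antisymm_iff]

theorem min {f g : Γ → ℕ} (hf : Feas f) (hg : Feas g) : Feas fun a => min (f a) (g a) :=
  ((hf.le hg).ite hf hg).of_rep fun a => by rw [min_def]

theorem bodd {f : Γ → ℕ} (hf : Feas f) : Feas fun a => (f a).bodd = Bool.true := by
  refine (hf.iter_prop false (s := fun _ _ v => ¬v) snd.wk.not).of_rep fun a => ?_
  congr 1
  generalize f a = n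
  induction n with
  | zero => simp [AdaptiveSync.iter]
  | succ n ih => rw [AdaptiveSync.iter, ih]; simp

/-- Half of `n` is the number of odd numbers below `n`, which a loop can count. -/
theorem div2 {f : Γ → ℕ} (hf : Feas f) : Feas fun a => (f a).div2 := by
  have e : ∀ n, AdaptiveSync.iter (fun i v => if i.bodd = Bool.true then v + 1 else v) 0 n =
      n.div2 := by
    intro n
    induction n with
    | zero => rfl
    | succ n ih =>
      rw [AdaptiveSync.iter, ih, Nat.div2_succ]
      cases n.bodd <;> rfl
  refine (hf.iter_of_le zero (s := fun _ i v => if i.bodd = Bool.true then v + 1 else v)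
    (snd.bodd.ite snd.wk.succ snd.wk) hf fun a i hi => ?_).of_rep fun a => by rw [e]
  rw [e, rep_nat_length, rep_nat_length, Nat.div2_val]
  omega

theorem testBit {f g : Γ → ℕ} (hf : Feas f) (hg : Feas g) :
    Feas fun a => (f a).testBit (g a) = Bool.true := by
  have e : ∀ x i : ℕ, Nat.div2^[i] x = x >>> i := by
    intro x i
    induction i with
    | zero => rfl
    | succ i ih => rw [Function.iterate_succ_apply', ih, Nat.div2_val, Nat.shiftRight_succ]
  refine (iterate hg hf (s := fun _ v => v.div2) snd.div2 hf fun a i _ => ?_).bodd.of_rep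
    fun a => ?_
  · change (rep (Nat.div2^[i] (f a))).length ≤ _
    rw [e, rep_nat_length, rep_nat_length]
    exact Nat.shiftRight_le _ _
  · change rep ((Nat.div2^[g a] (f a)).bodd = _) = _
    rw [e, Nat.bodd_eq_one_and_ne_zero]
    rfl

/-! ### Words -/

theorem tail {f : Γ → List Symbol} (hf : Feas f) : Feas fun a => (f a).tail :=
  (hf.listCase nil (b := fun _ _ l => l) fun _ => snd).of_rep fun a => by cases f a <;> rfl

theorem drop {n : Γ → ℕ} {f : Γ → List Symbol} (hn : Feas n) (hf : Feas f) :
    Feas fun a => (f a).drop (n a) := by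
  have e : ∀ (l : List Symbol) (i : ℕ), List.tail^[i] l = l.drop i := by
    intro l i
    induction i generalizing l with
    | zero => rfl
    | succ i ih => rw [Function.iterate_succ_apply, ih, List.drop_tail]
  refine (iterate hn hf (s := fun _ v => v.tail) snd.tail hf fun a i _ => ?_).of_rep fun a => ?_
  · change (List.tail^[i] (f a)).length ≤ (f a).length
    rw [e, List.length_drop]
    omega
  · exact congrArg rep (e _ _)

theorem starts (q : Symbol → Bool) {f : Γ → List Symbol} (hf : Feas f) :
    Feas fun a => Starts q (f a) :=
  hf.listCase false fun c => by
    cases q c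
    · simpa using false
    · simpa using true

open Classical in
-- One symbol is dropped per round; once the first symbol fails the test further rounds do nothing,
-- so as many rounds as the word is long suffice.
theorem dropWhile (q : Symbol → Bool) {f : Γ → List Symbol} (hf : Feas f) :
    Feas fun a => (f a).dropWhile q := by
  have e : ∀ (n : ℕ) (l : List Symbol), l.length ≤ n →
      (fun v => if Starts q v then v.tail else v)^[n] l = l.dropWhile q := by
    intro n
    induction n with
    | zero => intro l hl; rw [List.length_eq_zero_iff.1 (Nat.le_zero.1 hl)]; rfl
    | succ n ih =>
      intro l hl
      rw [Function.iterate_succ_apply]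
      rcases l with _ | ⟨c, l⟩
      · rw [ih _ (by simp [Starts, AdaptiveSync.listCase])]; simp [Starts, AdaptiveSync.listCase]
      · by_cases h : q c
        · simpa [Starts, AdaptiveSync.listCase, h] using ih l (by simpa using hl)
        · have : ∀ m, (fun v => if Starts q v then v.tail else v)^[m] (c :: l) = c :: l :=
            fun m => Function.iterate_fixed (by simp [Starts, AdaptiveSync.listCase, h]) m
          simpa [Starts, AdaptiveSync.listCase, h] using this n
  refine (iterate hf.length hf (s := fun _ v => if Starts q v then v.tail else v)
    ((snd.starts q).ite snd.tail snd) hf fun a i _ => ?_).of_rep fun a => ?_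
  · change (_^[i] (f a)).length ≤ (f a).length
    induction i with
    | zero => exact le_rfl
    | succ i ih =>
      rw [Function.iterate_succ_apply']
      refine le_trans ?_ (ih (by omega))
      split_ifs
      · rw [List.length_tail]; omega
      · exact le_rfl
  · exact congrArg rep (e _ _ le_rfl)

end Feas

end AdaptiveSync

/-! ### The saturation algorithm on encoded instances and its feasibility. -/

namespace AdaptiveSync

open AdaptiveSync.Rep

/-! ### Bounded search, sets as numbers, tables -/

open Classical in
/-- The least number below `n` with the property `p`, or `n`. -/
noncomputable def mu (n : ℕ) (p : ℕ → Prop) : ℕ :=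
  iter (fun i v => if v = i ∧ ¬p i then i + 1 else v) 0 n

/-- The least number below `M` whose first `n` bits are given by `p`. -/
noncomputable def bitsNum (M n : ℕ) (p : ℕ → Prop) : ℕ :=
  mu M fun z => ∀ i < n, (z.testBit i = true ↔ p i)

/-- The number `2 ^ k` as long as it is at most `M`. -/
def powTwo (M k : ℕ) : ℕ := iter (fun _ v => min (v + v) M) 1 k

open Classical in
/-- The table of the values of `p` below `n`, the last one first. -/
noncomputable def table (n : ℕ) (p : ℕ → Prop) : List Symbol :=
  iter (fun i v => if p i then Symbol.tally :: v else Symbol.comma :: v) [] n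

/-- An entry of a table. -/
def lookup (T : List Symbol) (j : ℕ) : Prop :=
  j < T.length ∧ Starts (· = Symbol.tally) (T.drop (T.length - 1 - j))

/-- The accumulator equals the round number exactly as long as no witness has been found; this
equality is the flag that keeps the search going. -/
theorem mu_spec (n : ℕ) (p : ℕ → Prop) :
    mu n p ≤ n ∧ (∀ j < mu n p, ¬p j) ∧ (mu n p < n → p (mu n p)) := by
  unfold mu
  induction n with
  | zero => simp [iter]
  | succ n ih =>
    obtain ⟨h₁, h₂, h₃⟩ := ih
    rw [iter]
    split_ifs with h
    · refine ⟨le_rfl, fun j hj => ?_, fun h => absurd h (lt_irrefl _)⟩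
      rcases Nat.lt_succ_iff_lt_or_eq.1 hj with hj | rfl
      · exact h₂ j (by rwa [h.1])
      · exact h.2
    · refine ⟨by omega, h₂, fun _ => ?_⟩
      rcases h₁.lt_or_eq with h₄ | h₄
      · exact h₃ h₄
      · rw [h₄]
        by_contra h₅
        exact h ⟨h₄, h₅⟩

theorem mu_le_of {n : ℕ} {p : ℕ → Prop} {z : ℕ} (hz : p z) (hn : z < n) :
    mu n p ≤ z ∧ p (mu n p) := by
  obtain ⟨-, h₂, h₃⟩ := mu_spec n p
  have h : mu n p ≤ z := not_lt.1 fun h => h₂ z h hz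
  exact ⟨h, h₃ (by omega)⟩

theorem bitsNum_le (M n : ℕ) (p : ℕ → Prop) : bitsNum M n p ≤ M := (mu_spec _ _).1

open Classical in
-- A feasible search needs its range in unary, hence the argument `M`. The hypothesis puts the
-- number with the required bits into the range, and the least candidate is no larger than it.
theorem bitsNum_spec {M n : ℕ} (p : ℕ → Prop) (h : 2 ^ n ≤ M) :
    bitsNum M n p < 2 ^ n ∧ ∀ i < n, ((bitsNum M n p).testBit i = true ↔ p i) := by
  have hz : ∀ i < n, ((Nat.ofBits fun i : Fin n => decide (p i)).testBit i = true ↔ p i) := by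
    intro i hi
    rw [Nat.testBit_ofBits_lt _ _ hi]
    simp
  have hlt := Nat.ofBits_lt_two_pow fun i : Fin n => decide (p i)
  obtain ⟨h₁, h₂⟩ := mu_le_of (p := fun z => ∀ i < n, (z.testBit i = true ↔ p i)) hz
    (hlt.trans_le h)
  exact ⟨h₁.trans_lt hlt, h₂⟩

/-- The cap `M` keeps repeated doubling feasible and has no effect while the true power stays within
it. -/
theorem powTwo_eq {M k : ℕ} (h : 2 ^ k ≤ M) : powTwo M k = 2 ^ k := by
  induction k with
  | zero => rfl
  | succ k ih =>
    have h' : 2 ^ k ≤ M := (Nat.pow_le_pow_right (by omega) (Nat.le_succ k)).trans h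
    change min (powTwo M k + powTwo M k) M = _
    rw [ih h', pow_succ]
    rw [pow_succ] at h
    omega

theorem length_table (n : ℕ) (p : ℕ → Prop) : (table n p).length = n := by
  unfold table
  induction n with
  | zero => rfl
  | succ n ih => rw [iter]; split_ifs <;> rw [List.length_cons, ih]

/-- New entries are put in front, so entry `j` stands `n - 1 - j` symbols after the start. -/
theorem lookup_table {n : ℕ} {p : ℕ → Prop} {j : ℕ} : lookup (table n p) j ↔ j < n ∧ p j := by
  rw [lookup, length_table]
  refine and_congr_right fun hj => ?_
  induction n with
  | zero => omega
  | succ n ih =>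
    rw [table, iter]
    rcases Nat.lt_succ_iff_lt_or_eq.1 hj with h | rfl
    · have e : n + 1 - 1 - j = (n - 1 - j) + 1 := by omega
      rw [e]
      split_ifs <;> exact ih h
    · have e : j + 1 - 1 - j = 0 := by omega
      rw [e, List.drop_zero]
      split_ifs with h <;> simp [Starts, listCase, h]

/-! ### Reading instances -/

/-- The number at the beginning of a text. -/
def fld (l : List Symbol) : ℕ := l.length - (l.dropWhile (· = Symbol.tally)).length

/-- The text after the number at its beginning. -/
def rst (l : List Symbol) : List Symbol := (l.dropWhile (· = Symbol.tally)).tail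

/-- A text begins with a number. -/
def IsNum (l : List Symbol) : Prop := Starts (· = Symbol.comma) (l.dropWhile (· = Symbol.tally))

/-- A list in a text is at its end. -/
def AtEnd (l : List Symbol) : Prop := Starts (· = Symbol.semicolon) l

/-- A list in a text has another element. -/
def More (l : List Symbol) : Prop := Starts (· ≠ Symbol.semicolon) l

open Classical in
/-- Skip a number of a list. -/
noncomputable def skipElem (l : List Symbol) : List Symbol := if More l then rst l else l

open Classical in
/-- Read a number below `b`. -/
noncomputable def readNum (b : ℕ) (l : List Symbol) : List Symbol :=
  if IsNum l ∧ fld l < b then rst l else []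

open Classical in
/-- Read a number below `b` in a list, unless the list is at its end. -/
noncomputable def readElem (b : ℕ) (l : List Symbol) : List Symbol :=
  if AtEnd l then l else readNum b l

open Classical in
/-- Read a list of numbers below `b`. -/
noncomputable def readList (b : ℕ) (l : List Symbol) : List Symbol :=
  if AtEnd ((readElem b)^[l.length] l) then ((readElem b)^[l.length] l).tail else []

/-- The text from the `k`-th pushed symbol of a transition on. -/
noncomputable def pushAt (l : List Symbol) (k : ℕ) : List Symbol :=
  skipElem^[k] (rst (rst (rst (rst l))))

/-- The last symbol that a transition pushes is `b`. -/
def PushesLast (b : ℕ) (l : List Symbol) : Prop :=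
  ∃ k < l.length, More (pushAt l k) ∧ fld (pushAt l k) = b ∧ AtEnd (rst (pushAt l k))

open Classical in
/-- Read a transition, unless the list is at its end. -/
noncomputable def readRule (n m g b : ℕ) (l : List Symbol) : List Symbol :=
  if AtEnd l then l
  else if fld (rst (rst l)) = b → PushesLast b l then
    readList g (readNum n (readNum g (readNum m (readNum n l))))
  else []

def numStatesOf (w : List Symbol) : ℕ := fld w
def numLettersOf (w : List Symbol) : ℕ := fld (rst w)
def numStackOf (w : List Symbol) : ℕ := fld (rst (rst w))
def botOf (w : List Symbol) : ℕ := fld (rst (rst (rst w)))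
def targetOf (w : List Symbol) : ℕ := fld (rst (rst (rst (rst w))))
def initialText (w : List Symbol) : List Symbol := rst (rst (rst (rst (rst w))))

/-- The empty word signals that a check failed on the way. No ambiguity arises, because in a correct
text everything read here is followed by at least a semicolon. -/
noncomputable def rulesText (w : List Symbol) : List Symbol :=
  readList (numStatesOf w) (readNum (numStatesOf w) (readNum (numStackOf w) (rst (rst (rst w)))))

/-- The text from the `j`-th transition on. -/
noncomputable def ruleAt (w : List Symbol) (j : ℕ) : List Symbol :=
  (readRule (numStatesOf w) (numLettersOf w) (numStackOf w) (botOf w))^[j] (rulesText w)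

/-- The word encodes an instance. -/
def Valid (w : List Symbol) : Prop :=
  (IsNum w ∧ IsNum (rst w) ∧ IsNum (rst (rst w))) ∧
    AtEnd (ruleAt w w.length) ∧ (ruleAt w w.length).length = 1

/-! ### The saturation algorithm -/

/-- A transition may take place in the set `S` on the letter `a` with top symbol `X`. -/
def Match (S X a : ℕ) (l : List Symbol) : Prop :=
  S.testBit (fld l) = true ∧ fld (rst l) = a ∧ fld (rst (rst l)) = X

/-- Two transitions push the same word. -/
def SamePush (n : ℕ) (l l' : List Symbol) : Prop :=
  ∀ k < n, (More (pushAt l k) ↔ More (pushAt l' k)) ∧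
    (More (pushAt l k) → fld (pushAt l k) = fld (pushAt l' k))

/-- The set of target states of the class of a transition. -/
noncomputable def nextNum (w : List Symbol) (D S X a : ℕ) (l : List Symbol) : ℕ :=
  bitsNum D (numStatesOf w) fun q => ∃ j < w.length, More (ruleAt w j) ∧
    Match S X a (ruleAt w j) ∧ SamePush w.length l (ruleAt w j) ∧
      fld (rst (rst (rst (ruleAt w j)))) = q

/-- The number of sets of states. -/
def numSets (w : List Symbol) (D : ℕ) : ℕ := powTwo D (numStatesOf w)

/-- The number of families of sets of states. -/
def numFamilies (w : List Symbol) (D M : ℕ) : ℕ := powTwo M (numSets w D)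

/-- The index of a triple in the table. -/
def index (w : List Symbol) (D S X F : ℕ) : ℕ := (F * numStackOf w + X) * numSets w D + S

/-- The sets from which the table allows to pop `X` and to end in the family `F`. -/
noncomputable def preNum (w : List Symbol) (D M : ℕ) (T : List Symbol) (X F : ℕ) : ℕ :=
  bitsNum M (numSets w D) fun S => lookup T (index w D S X F)

open Classical in
/-- The sets from which the table allows to pop the word that a transition pushes and to end in the
family `F`. -/
noncomputable def backNum (w : List Symbol) (D M : ℕ) (T : List Symbol) (F : ℕ)
    (l : List Symbol) : ℕ :=
  iter (fun i v => if More (pushAt l (w.length - 1 - i)) then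
    preNum w D M T (fld (pushAt l (w.length - 1 - i))) v else v) F w.length

/-- The triples that are added to the table in one round. -/
def Derives (w : List Symbol) (D M : ℕ) (T : List Symbol) (S X F : ℕ) : Prop :=
  (X = botOf w ∧ (∀ q < numStatesOf w, (S.testBit q = true ↔ q = targetOf w)) ∧
    F.testBit 0 = true) ∨
  ∃ j < w.length, More (ruleAt w j) ∧ Match S X (fld (rst (ruleAt w j))) (ruleAt w j) ∧
    ∀ i < w.length, More (ruleAt w i) → Match S X (fld (rst (ruleAt w j))) (ruleAt w i) →
      (backNum w D M T F (ruleAt w i)).testBit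
        (nextNum w D S X (fld (rst (ruleAt w j))) (ruleAt w i)) = true

/-- The number of entries of the table. -/
def tableSize (w : List Symbol) (D M : ℕ) : ℕ :=
  numFamilies w D M * numStackOf w * numSets w D

/-- One round of the saturation. -/
noncomputable def saturate (w : List Symbol) (D M : ℕ) (T : List Symbol) : List Symbol :=
  table (tableSize w D M) fun z => ∃ S < numSets w D, ∃ X < numStackOf w,
    ∃ F < numFamilies w D M, z = index w D S X F ∧ Derives w D M T S X F

/-- The number of the set of initial states. -/
noncomputable def initialNum (w : List Symbol) (D : ℕ) : ℕ :=
  bitsNum D (numStatesOf w) fun q => ∃ k < w.length,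
    More (skipElem^[k] (initialText w)) ∧ fld (skipElem^[k] (initialText w)) = q

/-- The answer of the algorithm. -/
def Accepts (w : List Symbol) (D M : ℕ) : Prop :=
  Valid w ∧ lookup ((saturate w D M)^[tableSize w D M] [])
    (index w D (initialNum w D) (botOf w) 1)

/-! ### The algorithm is feasible -/

theorem length_rst_le (l : List Symbol) : (rst l).length ≤ l.length := by
  rw [rst, List.length_tail]
  exact (Nat.sub_le _ _).trans (List.length_dropWhile_le _ _)

theorem length_readNum_le (b : ℕ) (l : List Symbol) : (readNum b l).length ≤ l.length := by
  rw [readNum]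
  split_ifs
  · exact length_rst_le l
  · exact Nat.zero_le _

/-- Readers never lengthen a text; this discharges the size condition of `Feas.iterate`. -/
theorem length_iterate_le {f : List Symbol → List Symbol} (hf : ∀ l, (f l).length ≤ l.length)
    (k : ℕ) (l : List Symbol) : (f^[k] l).length ≤ l.length := by
  induction k with
  | zero => exact le_rfl
  | succ k ih => rw [Function.iterate_succ_apply']; exact (hf _).trans ih

theorem length_skipElem_le (l : List Symbol) : (skipElem l).length ≤ l.length := by
  rw [skipElem]
  split_ifs
  · exact length_rst_le l
  · exact le_rfl

theorem length_readElem_le (b : ℕ) (l : List Symbol) : (readElem b l).length ≤ l.length := by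
  rw [readElem]
  split_ifs
  · exact le_rfl
  · exact length_readNum_le b l

theorem length_readList_le (b : ℕ) (l : List Symbol) : (readList b l).length ≤ l.length := by
  rw [readList]
  split_ifs
  · rw [List.length_tail]
    exact (Nat.sub_le _ _).trans (length_iterate_le (length_readElem_le b) _ _)
  · exact Nat.zero_le _

theorem length_readRule_le (n m g b : ℕ) (l : List Symbol) :
    (readRule n m g b l).length ≤ l.length := by
  rw [readRule]
  split_ifs
  · exact le_rfl
  · exact (length_readList_le _ _).trans ((length_readNum_le _ _).trans
      ((length_readNum_le _ _).trans ((length_readNum_le _ _).trans (length_readNum_le _ _))))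
  · exact Nat.zero_le _

namespace Feas

variable {Γ : Type} [Ctx Γ]

theorem mu {n : Γ → ℕ} {p : Γ → ℕ → Prop} (hn : Feas n) (hp : Feas fun q : Γ × ℕ => p q.1 q.2) :
    Feas fun a => mu (n a) (p a) := by
  classical
  refine hn.iter_of_le zero (s := fun a i v => if v = i ∧ ¬p a i then i + 1 else v)
    (((snd.wk.eq snd).and hp.under.not).ite snd.succ snd.wk) hn fun a i hi => ?_
  rw [rep_nat_length, rep_nat_length]
  refine le_trans (le_of_eq ?_) ((mu_spec i (p a)).1.trans hi)
  rw [AdaptiveSync.mu]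

theorem bitsNum {M n : Γ → ℕ} {p : Γ → ℕ → Prop} (hM : Feas M) (hn : Feas n)
    (hp : Feas fun q : Γ × ℕ => p q.1 q.2) : Feas fun a => bitsNum (M a) (n a) (p a) :=
  hM.mu (hn.wk.forall_lt ((snd.wk.testBit snd).iff hp.under))

theorem powTwo {M k : Γ → ℕ} (hM : Feas M) (hk : Feas k) : Feas fun a => powTwo (M a) (k a) := by
  refine hk.iter_of_le (const 1) (s := fun a _ v => Min.min (v + v) (M a))
    ((snd.wk.add snd.wk).min hM.wk.wk) hM.succ fun a i _ => ?_
  rw [rep_nat_length, rep_nat_length]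
  cases i with
  | zero => exact Nat.le_add_left _ _
  | succ i => exact (min_le_right _ _).trans (Nat.le_succ _)

theorem table {n : Γ → ℕ} {p : Γ → ℕ → Prop} (hn : Feas n)
    (hp : Feas fun q : Γ × ℕ => p q.1 q.2) : Feas fun a => table (n a) (p a) := by
  classical
  refine hn.iter_of_le nil
    (s := fun a i v => if p a i then Symbol.tally :: v else Symbol.comma :: v)
    (hp.under.ite (snd.wk.cons _) (snd.wk.cons _)) hn fun a i hi => ?_
  rw [rep_nat_length]
  refine le_trans (le_of_eq ?_) ((length_table i (p a)).le.trans hi)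
  rw [AdaptiveSync.table]
  congr!

theorem lookup {T : Γ → List Symbol} {j : Γ → ℕ} (hT : Feas T) (hj : Feas j) :
    Feas fun a => lookup (T a) (j a) :=
  (hj.lt hT.length).and (((hT.length.sub (const 1)).sub hj).drop hT |>.starts _)

variable {f w T l : Γ → List Symbol} {b n m g k j D M S X F a : Γ → ℕ}

theorem fld (hf : Feas f) : Feas fun a => fld (f a) := hf.length.sub (hf.dropWhile _).length

theorem rst (hf : Feas f) : Feas fun a => rst (f a) := (hf.dropWhile _).tail

theorem isNum (hf : Feas f) : Feas fun a => IsNum (f a) := (hf.dropWhile _).starts _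

theorem atEnd (hf : Feas f) : Feas fun a => AtEnd (f a) := hf.starts _

theorem more (hf : Feas f) : Feas fun a => More (f a) := hf.starts _

open Classical in
theorem skipElem (hf : Feas f) : Feas fun a => skipElem (f a) := hf.more.ite hf.rst hf

open Classical in
theorem readNum (hb : Feas b) (hf : Feas f) : Feas fun a => readNum (b a) (f a) :=
  (hf.isNum.and (hf.fld.lt hb)).ite hf.rst nil

open Classical in
theorem readElem (hb : Feas b) (hf : Feas f) : Feas fun a => readElem (b a) (f a) :=
  hf.atEnd.ite hf (hb.readNum hf)

open Classical in
theorem readList (hb : Feas b) (hf : Feas f) : Feas fun a => readList (b a) (f a) := by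
  have h : Feas fun a => (AdaptiveSync.readElem (b a))^[(f a).length] (f a) :=
    hf.length.iterate hf (hb.wk.readElem snd) hf fun a i _ =>
      length_iterate_le (length_readElem_le _) i (f a)
  exact h.atEnd.ite h.tail nil

theorem skipElems (hk : Feas k) (hf : Feas f) :
    Feas fun a => AdaptiveSync.skipElem^[k a] (f a) :=
  hk.iterate hf (s := fun _ => AdaptiveSync.skipElem) snd.skipElem hf fun a i _ =>
    length_iterate_le length_skipElem_le i (f a)

theorem pushAt (hf : Feas f) (hk : Feas k) : Feas fun a => pushAt (f a) (k a) :=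
  hk.skipElems hf.rst.rst.rst.rst

theorem pushesLast (hb : Feas b) (hf : Feas f) : Feas fun a => PushesLast (b a) (f a) :=
  have h : Feas fun p : Γ × ℕ => AdaptiveSync.pushAt (f p.1) p.2 := hf.wk.pushAt snd
  hf.length.exists_lt (h.more.and ((h.fld.eq hb.wk).and h.rst.atEnd))

open Classical in
theorem readRule (hn : Feas n) (hm : Feas m) (hg : Feas g) (hb : Feas b) (hf : Feas f) :
    Feas fun a => readRule (n a) (m a) (g a) (b a) (f a) :=
  hf.atEnd.ite hf (((hf.rst.rst.fld.eq hb).imp (hb.pushesLast hf)).ite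
    (hg.readList (hn.readNum (hg.readNum (hm.readNum (hn.readNum hf))))) nil)

theorem numStatesOf (hw : Feas w) : Feas fun a => numStatesOf (w a) := hw.fld

theorem numLettersOf (hw : Feas w) : Feas fun a => numLettersOf (w a) := hw.rst.fld

theorem numStackOf (hw : Feas w) : Feas fun a => numStackOf (w a) := hw.rst.rst.fld

theorem botOf (hw : Feas w) : Feas fun a => botOf (w a) := hw.rst.rst.rst.fld

theorem targetOf (hw : Feas w) : Feas fun a => targetOf (w a) := hw.rst.rst.rst.rst.fld

theorem initialText (hw : Feas w) : Feas fun a => initialText (w a) := hw.rst.rst.rst.rst.rst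

theorem rulesText (hw : Feas w) : Feas fun a => rulesText (w a) :=
  hw.numStatesOf.readList (hw.numStatesOf.readNum (hw.numStackOf.readNum hw.rst.rst.rst))

theorem ruleAt (hw : Feas w) (hj : Feas j) : Feas fun a => ruleAt (w a) (j a) :=
  hj.iterate hw.rulesText
    (hw.wk.numStatesOf.readRule hw.wk.numLettersOf hw.wk.numStackOf hw.wk.botOf snd)
    hw.rulesText fun a i _ =>
      length_iterate_le (length_readRule_le _ _ _ _) i (AdaptiveSync.rulesText (w a))

theorem valid (hw : Feas w) : Feas fun a => Valid (w a) :=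
  (hw.isNum.and (hw.rst.isNum.and hw.rst.rst.isNum)).and
    ((hw.ruleAt hw.length).atEnd.and ((hw.ruleAt hw.length).length.eq (const 1)))

theorem matchRule (hS : Feas S) (hX : Feas X) (ha : Feas a) (hl : Feas l) :
    Feas fun x => Match (S x) (X x) (a x) (l x) :=
  (hS.testBit hl.fld).and ((hl.rst.fld.eq ha).and (hl.rst.rst.fld.eq hX))

theorem samePush (hn : Feas n) (hl : Feas l) (hf : Feas f) :
    Feas fun x => SamePush (n x) (l x) (f x) :=
  have h : Feas fun p : Γ × ℕ => AdaptiveSync.pushAt (l p.1) p.2 := hl.wk.pushAt snd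
  have h' : Feas fun p : Γ × ℕ => AdaptiveSync.pushAt (f p.1) p.2 := hf.wk.pushAt snd
  hn.forall_lt ((h.more.iff h'.more).and (h.more.imp (h.fld.eq h'.fld)))

theorem nextNum (hw : Feas w) (hD : Feas D) (hS : Feas S) (hX : Feas X) (ha : Feas a)
    (hl : Feas l) : Feas fun x => nextNum (w x) (D x) (S x) (X x) (a x) (l x) :=
  have h : Feas fun p : (Γ × ℕ) × ℕ => AdaptiveSync.ruleAt (w p.1.1) p.2 := hw.wk.wk.ruleAt snd
  hD.bitsNum hw.numStatesOf (hw.wk.length.exists_lt (h.more.and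
    ((hS.wk.wk.matchRule hX.wk.wk ha.wk.wk h).and ((hw.wk.wk.length.samePush hl.wk.wk h).and
      (h.rst.rst.rst.fld.eq snd.wk)))))

theorem numSets (hw : Feas w) (hD : Feas D) : Feas fun x => numSets (w x) (D x) :=
  hD.powTwo hw.numStatesOf

theorem numFamilies (hw : Feas w) (hD : Feas D) (hM : Feas M) :
    Feas fun x => numFamilies (w x) (D x) (M x) :=
  hM.powTwo (hw.numSets hD)

theorem index (hw : Feas w) (hD : Feas D) (hS : Feas S) (hX : Feas X) (hF : Feas F) :
    Feas fun x => index (w x) (D x) (S x) (X x) (F x) :=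
  (((hF.mul hw.numStackOf).add hX).mul (hw.numSets hD)).add hS

theorem preNum (hw : Feas w) (hD : Feas D) (hM : Feas M) (hT : Feas T) (hX : Feas X)
    (hF : Feas F) : Feas fun x => preNum (w x) (D x) (M x) (T x) (X x) (F x) :=
  hM.bitsNum (hw.numSets hD) (hT.wk.lookup (hw.wk.index hD.wk snd hX.wk hF.wk))

open Classical in
theorem backNum (hw : Feas w) (hD : Feas D) (hM : Feas M) (hT : Feas T) (hF : Feas F)
    (hl : Feas l) : Feas fun x => backNum (w x) (D x) (M x) (T x) (F x) (l x) := by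
  have h : Feas fun p : (Γ × ℕ) × ℕ =>
      AdaptiveSync.pushAt (l p.1.1) ((w p.1.1).length - 1 - p.2) :=
    hl.wk.wk.pushAt ((hw.wk.wk.length.sub (const 1)).sub snd)
  refine hw.length.iter_of_le hF (h.more.ite
    (hw.wk.wk.preNum hD.wk.wk hM.wk.wk hT.wk.wk h.fld snd.wk) snd.wk) (hM.add hF)
      fun x i _ => ?_
  rw [rep_nat_length, rep_nat_length]
  induction i with
  | zero => exact Nat.le_add_left _ _
  | succ i ih =>
    rw [AdaptiveSync.iter]
    split_ifs
    · exact (bitsNum_le _ _ _).trans (Nat.le_add_right _ _)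
    · exact ih (by omega)

theorem derives (hw : Feas w) (hD : Feas D) (hM : Feas M) (hT : Feas T) (hS : Feas S)
    (hX : Feas X) (hF : Feas F) :
    Feas fun x => Derives (w x) (D x) (M x) (T x) (S x) (X x) (F x) :=
  have h : Feas fun p : Γ × ℕ => AdaptiveSync.ruleAt (w p.1) p.2 := hw.wk.ruleAt snd
  have h' : Feas fun p : (Γ × ℕ) × ℕ => AdaptiveSync.ruleAt (w p.1.1) p.2 := hw.wk.wk.ruleAt snd
  ((hX.eq hw.botOf).and ((hw.numStatesOf.forall_lt
    ((hS.wk.testBit snd).iff (snd.eq hw.wk.targetOf))).and (hF.testBit zero))).or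
  (hw.length.exists_lt (h.more.and ((hS.wk.matchRule hX.wk h.rst.fld h).and
    (hw.wk.length.forall_lt (h'.more.imp ((hS.wk.wk.matchRule hX.wk.wk h.wk.rst.fld h').imp
      ((hw.wk.wk.backNum hD.wk.wk hM.wk.wk hT.wk.wk hF.wk.wk h').testBit
        (hw.wk.wk.nextNum hD.wk.wk hS.wk.wk hX.wk.wk h.wk.rst.fld h'))))))))

theorem tableSize (hw : Feas w) (hD : Feas D) (hM : Feas M) :
    Feas fun x => tableSize (w x) (D x) (M x) :=
  ((hw.numFamilies hD hM).mul hw.numStackOf).mul (hw.numSets hD)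

theorem saturate (hw : Feas w) (hD : Feas D) (hM : Feas M) (hT : Feas T) :
    Feas fun x => saturate (w x) (D x) (M x) (T x) :=
  (hw.tableSize hD hM).table ((hw.wk.numSets hD.wk).exists_lt (hw.wk.wk.numStackOf.exists_lt
    ((hw.wk.wk.wk.numFamilies hD.wk.wk.wk hM.wk.wk.wk).exists_lt
      ((snd.wk.wk.wk.eq (hw.wk.wk.wk.wk.index hD.wk.wk.wk.wk snd.wk.wk snd.wk snd)).and
        (hw.wk.wk.wk.wk.derives hD.wk.wk.wk.wk hM.wk.wk.wk.wk hT.wk.wk.wk.wk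
          snd.wk.wk snd.wk snd)))))

theorem initialNum (hw : Feas w) (hD : Feas D) : Feas fun x => initialNum (w x) (D x) :=
  have h : Feas fun p : (Γ × ℕ) × ℕ =>
      AdaptiveSync.skipElem^[p.2] (AdaptiveSync.initialText (w p.1.1)) :=
    snd.skipElems hw.wk.wk.initialText
  hD.bitsNum hw.numStatesOf (hw.wk.length.exists_lt (h.more.and (h.fld.eq snd.wk)))

theorem accepts (hw : Feas w) (hD : Feas D) (hM : Feas M) :
    Feas fun x => Accepts (w x) (D x) (M x) := by
  refine hw.valid.and (lookup ?_ (hw.index hD (hw.initialNum hD) hw.botOf (const 1)))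
  refine (hw.tableSize hD hM).iterate nil (hw.wk.saturate hD.wk hM.wk snd)
    (hw.tableSize hD hM) fun x i _ => ?_
  rw [rep_nat_length]
  -- From the first round on the table has exactly `tableSize` entries, whatever it contains.
  cases i with
  | zero => exact Nat.zero_le _
  | succ i =>
    rw [Function.iterate_succ_apply']
    exact (length_table _ _).le

end Feas

end AdaptiveSync

/-! ### The combinatorial core: super-synchronisers as a fixed point of saturation. -/

namespace AdaptiveSync

/-! ### Relations between sets and families of sets -/

section Relations

variable {Q G : Type}

/-- Relations between sets, stack symbols and families of sets. -/
abbrev Rel (Q G : Type) : Type := Finset Q → G → Set (Finset Q) → Prop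

/-- The sets from which `R` allows to pop a word and to end in the family `F`. -/
def Rel.back (R : Rel Q G) (γ : List G) (F : Set (Finset Q)) : Set (Finset Q) :=
  γ.foldr (fun X F => {S | R S X F}) F

theorem Rel.back_mono {R R' : Rel Q G} (h : ∀ S X F, R S X F → R' S X F) (γ : List G)
    (F : Set (Finset Q)) (hR : ∀ S X F F', F ⊆ F' → R' S X F → R' S X F') :
    R.back γ F ⊆ R'.back γ F := by
  induction γ with
  | nil => exact subset_rfl
  | cons X γ ih => exact fun S hS => hR _ _ _ _ ih (h _ _ _ hS)

theorem Rel.back_mono_right {R : Rel Q G} (hR : ∀ S X F F', F ⊆ F' → R S X F → R S X F')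
    (γ : List G) {F F' : Set (Finset Q)} (hF : F ⊆ F') : R.back γ F ⊆ R.back γ F' := by
  induction γ with
  | nil => exact hF
  | cons X γ ih => exact fun S hS => hR _ _ _ _ ih hS

end Relations

/-! ### Synchronisers as derivations -/

section Derivations

variable {Q A G : Type} [DecidableEq Q] [DecidableEq A] [DecidableEq G]

/-- From `(S, γ)` the observer can force the empty stack with a set in `F`, or, if `F` contains
the empty set, the pseudo-configuration `({s}, ⊥)`. -/
inductive Wins (P : PDA Q A G) (s : Q) (F : Set (Finset Q)) : Finset Q → List G → Prop
  | empty {S : Finset Q} : S ∈ F → Wins P s F S []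
  | leaf : ∅ ∈ F → Wins P s F {s} [P.bot]
  | node {S : Finset Q} {X : G} {η : List G} (a : A) : (P.possible S X a).Nonempty →
      (∀ c ∈ P.succs S X η a, Wins P s F c.1 c.2) → Wins P s F S (X :: η)

variable {P : PDA Q A G} {s : Q}

theorem PDA.mem_succs {S : Finset Q} {X : G} {η : List G} {a : A} {c : PseudoConfig Q G} :
    c ∈ P.succs S X η a ↔ ∃ t ∈ P.possible S X a,
      c = ((P.indistClass S X a t).image Transition.dst, t.push ++ η) := by
  simp only [PDA.succs, Finset.mem_image, eq_comm]

theorem PDA.possible_empty (X : G) (a : A) : P.possible ∅ X a = ∅ := by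
  simp [PDA.possible]

/-- Real moves never lead to the empty set, which is therefore free to mark that `({s}, ⊥)` has been
reached. -/
theorem PDA.next_nonempty {S : Finset Q} {X : G} {a : A} {t : Transition Q A G}
    (ht : t ∈ P.possible S X a) : ((P.indistClass S X a t).image Transition.dst).Nonempty :=
  ⟨t.dst, Finset.mem_image_of_mem _ (Finset.mem_filter.2 ⟨ht, rfl⟩)⟩

theorem Wins.of_tree {T : Tree Q A G} (hr : T.Respects P)
    (hl : T.AllLeaves fun c => c = ({s}, [P.bot])) : Wins P s {∅} T.label.1 T.label.2 := by
  induction T with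
  | leaf c =>
    obtain rfl : c = ({s}, [P.bot]) := hl
    exact .leaf rfl
  | node c a k child ih =>
    obtain ⟨hk, ⟨X, η, hc, -, hrange⟩, hch⟩ := hr
    have h : Wins P s {∅} c.1 c.2 := by
      rw [hc]
      refine .node a ?_ fun d hd => ?_
      · have : (child ⟨0, hk⟩).label ∈ (P.succs c.1 X η a : Set (PseudoConfig Q G)) :=
          hrange ▸ Set.mem_range_self _
        obtain ⟨t, ht, -⟩ := PDA.mem_succs.1 this
        exact ⟨t, ht⟩
      · have : d ∈ Set.range fun i => (child i).label := hrange ▸ hd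
        obtain ⟨i, rfl⟩ := this
        exact ih i (hch i) (hl i)
    exact h

/-- Nonemptiness passes from a set to its successors, so the rule `empty` is never used for the
family `{∅}` and every branch of the derivation ends in a proper leaf. -/
theorem Wins.exists_tree {S : Finset Q} {γ : List G} (h : Wins P s {∅} S γ) (hS : S ≠ ∅) :
    ∃ T, IsSuperSynchroniser P S γ s T := by
  induction h with
  | empty h => exact absurd h hS
  | leaf => exact ⟨.leaf _, rfl, trivial, rfl⟩
  | @node S X η a hne _ ih =>
    have ih' : ∀ c : P.succs S X η a, ∃ T, IsSuperSynchroniser P c.1.1 c.1.2 s T := by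
      rintro ⟨c, hc⟩
      refine ih c hc ?_
      obtain ⟨t, ht, rfl⟩ := PDA.mem_succs.1 hc
      exact (PDA.next_nonempty ht).ne_empty
    choose T hT using ih'
    -- Enumerating the successors by a bijection makes each of them label exactly one child.
    let e := (P.succs S X η a).equivFin.symm
    have hlab : ∀ i, (T (e i)).label = (e i).1 := fun i => (hT (e i)).1
    refine ⟨.node (S, X :: η) a _ fun i => T (e i), rfl, ⟨?_, ⟨X, η, rfl, ?_, ?_⟩, fun i =>
      (hT _).2.1⟩, fun i => (hT _).2.2⟩
    · obtain ⟨t, ht⟩ := hne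
      exact Finset.card_pos.2 ⟨_, PDA.mem_succs.2 ⟨t, ht, rfl⟩⟩
    · intro i j hij
      simp only [hlab] at hij
      exact e.injective (Subtype.ext hij)
    · ext c
      simp only [hlab, Set.mem_range]
      constructor
      · rintro ⟨i, rfl⟩
        exact (e i).2
      · intro hc
        exact ⟨e.symm ⟨c, hc⟩, by rw [e.apply_symm_apply]⟩

theorem not_wins_empty {F : Set (Finset Q)} {X : G} {η : List G} : ¬Wins P s F ∅ (X :: η) := by
  generalize hS : (∅ : Finset Q) = S
  generalize hγ : X :: η = γ
  intro h
  cases h with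
  | empty => cases hγ
  | leaf => exact absurd hS.symm (Finset.singleton_ne_empty s)
  | node a hne =>
    rw [← hS, PDA.possible_empty] at hne
    exact absurd hne Finset.not_nonempty_empty

theorem exists_superSynchroniser_iff {S : Finset Q} {X : G} {η : List G} :
    (∃ T, IsSuperSynchroniser P S (X :: η) s T) ↔ Wins P s {∅} S (X :: η) := by
  constructor
  · rintro ⟨T, hl, hr, ha⟩
    have := Wins.of_tree hr ha
    rwa [hl] at this
  · intro h
    refine h.exists_tree ?_
    rintro rfl
    exact not_wins_empty h

/-- The derivation for `γ` is continued at its ends. At an end of kind `leaf` the continuation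
starts from `∅`, which forces `η = []` and `∅ ∈ F`: the label `({s}, ⊥)` counts only with nothing
below it. -/
theorem Wins.append {F F' : Set (Finset Q)} {S : Finset Q} {γ η : List G}
    (h : Wins P s F' S γ) (h' : ∀ S' ∈ F', Wins P s F S' η) : Wins P s F S (γ ++ η) := by
  induction h with
  | empty h => exact h' _ h
  | leaf h =>
    have h₁ := h' _ h
    cases η with
    | nil =>
      generalize hS : (∅ : Finset Q) = S at h₁
      generalize hγ : ([] : List G) = γ at h₁
      cases h₁ with
      | empty h₂ => exact .leaf (hS ▸ h₂)
      | leaf => cases hγ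
      | node => cases hγ
    | cons X η => exact absurd h₁ not_wins_empty
  | @node S X η₀ a hne _ ih =>
    refine .node a hne fun c hc => ?_
    obtain ⟨t, ht, rfl⟩ := PDA.mem_succs.1 hc
    have := ih _ (PDA.mem_succs.2 ⟨t, ht, rfl⟩)
    rwa [List.append_assoc] at this

/-! ### Saturation -/

/-- One round of the saturation. -/
def PDA.saturate (P : PDA Q A G) (s : Q) (R : Rel Q G) : Rel Q G := fun S X F =>
  (X = P.bot ∧ S = {s} ∧ ∅ ∈ F) ∨ ∃ a, (P.possible S X a).Nonempty ∧
    ∀ t ∈ P.possible S X a, (P.indistClass S X a t).image Transition.dst ∈ R.back t.push F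

/-- The relation after `i` rounds. -/
def PDA.round (P : PDA Q A G) (s : Q) (i : ℕ) : Rel Q G :=
  (P.saturate s)^[i] fun _ _ _ => False

theorem PDA.round_succ (i : ℕ) : P.round s (i + 1) = P.saturate s (P.round s i) :=
  Function.iterate_succ_apply' ..

theorem PDA.round_mono_right (i : ℕ) : ∀ S X F F', F ⊆ F' → P.round s i S X F →
    P.round s i S X F' := by
  induction i with
  | zero => exact fun _ _ _ _ _ h => h
  | succ i ih =>
    rw [PDA.round_succ]
    rintro S X F F' hF (⟨h₁, h₂, h₃⟩ | ⟨a, h₁, h₂⟩)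
    · exact .inl ⟨h₁, h₂, hF h₃⟩
    · exact .inr ⟨a, h₁, fun t ht => Rel.back_mono_right ih _ hF (h₂ t ht)⟩

theorem PDA.round_le_succ (i : ℕ) : ∀ S X F, P.round s i S X F → P.round s (i + 1) S X F := by
  induction i with
  | zero => exact fun _ _ _ h => h.elim
  | succ i ih =>
    intro S X F h
    rw [PDA.round_succ] at h ⊢
    rcases h with h | ⟨a, h₁, h₂⟩
    · exact .inl h
    · exact .inr ⟨a, h₁, fun t ht =>
        Rel.back_mono ih _ _ (PDA.round_mono_right _) (h₂ t ht)⟩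

/-- The rounds form an increasing chain of sets of triples. Each round adds a triple until two
consecutive rounds agree, and from then on nothing changes; there are at most `n` triples to add. -/
theorem PDA.round_fixed [Fintype Q] [Fintype G] {n : ℕ}
    (hn : Nat.card (Finset Q × G × Set (Finset Q)) ≤ n) :
    P.round s (n + 1) = P.round s n := by
  classical
  let U : ℕ → Finset (Finset Q × G × Set (Finset Q)) := fun i =>
    Finset.univ.filter fun p => P.round s i p.1 p.2.1 p.2.2
  have hU : ∀ i, U i ⊆ U (i + 1) := fun i p hp => by
    simp only [U, Finset.mem_filter, Finset.mem_univ, true_and] at hp ⊢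
    exact P.round_le_succ i _ _ _ hp
  have hUR : ∀ i j, U i = U j → P.round s i = P.round s j := by
    intro i j h
    funext S X F
    have := congrArg (fun V => (S, X, F) ∈ V) h
    simpa [U] using this
  have hfix : ∀ i, U (i + 1) = U i → ∀ j, P.round s (i + j) = P.round s i := by
    intro i h j
    induction j with
    | zero => rfl
    | succ j ih => rw [← add_assoc, PDA.round_succ, ih, ← PDA.round_succ, hUR _ _ h]
  have key : ∀ i, i ≤ (U i).card ∨ ∃ j < i, U (j + 1) = U j := by
    intro i
    induction i with
    | zero => exact .inl (Nat.zero_le _)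
    | succ i ih =>
      rcases ih with h | ⟨j, hj, h⟩
      · by_cases h' : U (i + 1) = U i
        · exact .inr ⟨i, Nat.lt_succ_self i, h'⟩
        · exact .inl (h.trans_lt (Finset.card_lt_card ((hU i).ssubset_of_ne (Ne.symm h'))))
      · exact .inr ⟨j, hj.trans (Nat.lt_succ_self i), h⟩
  rcases key (n + 1) with h | ⟨j, hj, h⟩
  · have := (U (n + 1)).card_le_univ
    rw [Nat.card_eq_fintype_card] at hn
    omega
  · have h₁ := hfix j h (n - j)
    have h₂ := hfix j h (n + 1 - j)
    rw [show j + (n - j) = n by omega] at h₁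
    rw [show j + (n + 1 - j) = n + 1 by omega] at h₂
    rw [h₁, h₂]

/-- A word is popped symbol by symbol, and `Wins.append` glues the derivations together. -/
theorem Wins.of_back {R : Rel Q G} (hR : ∀ S X F, R S X F → Wins P s F S [X]) {γ : List G}
    {F : Set (Finset Q)} {S : Finset Q} (h : S ∈ R.back γ F) : Wins P s F S γ := by
  induction γ generalizing S with
  | nil => exact .empty h
  | cons X γ ih => exact (hR _ _ _ h).append fun S' hS' => ih hS'

theorem Wins.of_round {i : ℕ} : ∀ S X F, P.round s i S X F → Wins P s F S [X] := by
  induction i with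
  | zero => exact fun _ _ _ h => h.elim
  | succ i ih =>
    rw [PDA.round_succ]
    rintro S X F (⟨rfl, rfl, h⟩ | ⟨a, h₁, h₂⟩)
    · exact .leaf h
    · refine .node a h₁ fun c hc => ?_
      obtain ⟨t, ht, rfl⟩ := PDA.mem_succs.1 hc
      rw [List.append_nil]
      exact Wins.of_back ih (h₂ t ht)

/-- For a node with stack `X :: η`, the family to aim at when popping `X` is `R.back η F`. As
`R.back (γ ++ η) F = R.back γ (R.back η F)`, the induction hypotheses on the children are what
saturation needs to derive the triple `(S, X, R.back η F)`. -/
theorem Wins.mem_back {R : Rel Q G} (hR : P.saturate s R = R) {F : Set (Finset Q)}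
    {S : Finset Q} {γ : List G} (h : Wins P s F S γ) : S ∈ R.back γ F := by
  have hR' : ∀ S X F, P.saturate s R S X F → R S X F := fun S X F h => by rwa [hR] at h
  induction h with
  | empty h => exact h
  | leaf h => exact hR' _ _ _ (.inl ⟨rfl, rfl, h⟩)
  | @node S X η a h₁ _ ih =>
    refine hR' _ _ _ (.inr ⟨a, h₁, fun t ht => ?_⟩)
    have := ih _ (PDA.mem_succs.2 ⟨t, ht, rfl⟩)
    rw [Rel.back, List.foldr_append] at this
    exact this

theorem exists_superSynchroniser_iff_round [Fintype Q] [Fintype G] {n : ℕ}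
    (hn : Nat.card (Finset Q × G × Set (Finset Q)) ≤ n) {S : Finset Q} {X : G} :
    (∃ T, IsSuperSynchroniser P S [X] s T) ↔ P.round s n S X {∅} := by
  rw [exists_superSynchroniser_iff]
  refine ⟨fun h => ?_, Wins.of_round _ _ _⟩
  exact h.mem_back ((PDA.round_succ n).symm.trans (PDA.round_fixed hn))

end Derivations

end AdaptiveSync

/-! ### Parsing and validation of encoded instances. -/

namespace AdaptiveSync

open AdaptiveSync.Symbol

/-! ### Correctness of the reading functions -/

theorem dropWhile_encodeNat (m : ℕ) (x : List Symbol) :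
    (encodeNat m ++ x).dropWhile (· = tally) = comma :: x := by
  induction m with
  | zero => rfl
  | succ m ih => exact ih

@[simp] theorem length_encodeNat (m : ℕ) : (encodeNat m).length = m + 1 := by simp [encodeNat]

@[simp] theorem fld_encodeNat (m : ℕ) (x : List Symbol) : fld (encodeNat m ++ x) = m := by
  rw [fld, dropWhile_encodeNat, List.length_append, length_encodeNat, List.length_cons]
  omega

@[simp] theorem rst_encodeNat (m : ℕ) (x : List Symbol) : rst (encodeNat m ++ x) = x := by
  rw [rst, dropWhile_encodeNat, List.tail_cons]

@[simp] theorem isNum_encodeNat (m : ℕ) (x : List Symbol) : IsNum (encodeNat m ++ x) := by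
  rw [IsNum, dropWhile_encodeNat]
  simp [Starts, listCase]

theorem IsNum.eq {l : List Symbol} (h : IsNum l) : l = encodeNat (fld l) ++ rst l := by
  have h₁ := List.takeWhile_append_dropWhile (p := (· = tally)) (l := l)
  have h₂ : l.takeWhile (· = tally) = List.replicate (fld l) tally := by
    refine List.eq_replicate_iff.2 ⟨?_, fun b hb => ?_⟩
    · have := congrArg List.length h₁
      rw [List.length_append] at this
      rw [fld]
      omega
    · simpa using List.mem_takeWhile_imp hb
  have h₃ : l.dropWhile (· = tally) = comma :: rst l := by
    rw [IsNum] at h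
    rw [rst]
    rcases h' : l.dropWhile (· = tally) with _ | ⟨c, l'⟩
    · rw [h'] at h; exact h.elim
    · rw [h'] at h
      have : c = comma := by simpa [Starts, listCase] using h
      rw [this, List.tail_cons]
  conv_lhs => rw [← h₁, h₂, h₃]
  simp [encodeNat]

theorem atEnd_iff {l : List Symbol} : AtEnd l ↔ l = semicolon :: l.tail := by
  cases l <;> simp [AtEnd, Starts, listCase]

@[simp] theorem atEnd_semicolon (x : List Symbol) : AtEnd (semicolon :: x) := by
  simp [AtEnd, Starts, listCase]

@[simp] theorem not_atEnd_nil : ¬AtEnd [] := id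

@[simp] theorem not_more_semicolon (x : List Symbol) : ¬More (semicolon :: x) := by
  simp [More, Starts, listCase]

@[simp] theorem not_atEnd_encodeNat (m : ℕ) (x : List Symbol) : ¬AtEnd (encodeNat m ++ x) := by
  cases m <;> simp [AtEnd, Starts, listCase, encodeNat, List.replicate_succ]

@[simp] theorem more_encodeNat (m : ℕ) (x : List Symbol) : More (encodeNat m ++ x) := by
  cases m <;> simp [More, Starts, listCase, encodeNat, List.replicate_succ]

theorem readNum_encodeNat {b m : ℕ} (h : m < b) (x : List Symbol) :
    readNum b (encodeNat m ++ x) = x := by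
  rw [readNum, if_pos ⟨isNum_encodeNat m x, by rwa [fld_encodeNat]⟩, rst_encodeNat]

@[simp] theorem readNum_encodeFin {b : ℕ} (i : Fin b) (x : List Symbol) :
    readNum b (encodeFin i ++ x) = x := readNum_encodeNat i.2 x

/-- A nonempty result certifies success, since failure returns `[]`; in a correct text something
always follows a number. -/
theorem readNum_sound {b : ℕ} {l : List Symbol} (h : readNum b l ≠ []) :
    ∃ i : Fin b, l = encodeFin i ++ readNum b l := by
  rw [readNum] at h ⊢
  split_ifs at h ⊢ with h₁
  · exact ⟨⟨fld l, h₁.2⟩, h₁.1.eq⟩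
  · exact absurd rfl h

theorem readNum_nil (b : ℕ) : readNum b [] = [] := if_neg fun h => h.1

section Lists

variable {α : Type} {enc : α → List Symbol}

@[simp] theorem encodeList_nil_append (x : List Symbol) :
    encodeList enc [] ++ x = semicolon :: x := rfl

@[simp] theorem encodeList_cons_append (a : α) (u : List α) (x : List Symbol) :
    encodeList enc (a :: u) ++ x = enc a ++ (encodeList enc u ++ x) := by
  simp [encodeList]

theorem length_le_length_encodeList (h : ∀ a, enc a ≠ []) (u : List α) :
    u.length + 1 ≤ (encodeList enc u).length := by
  induction u with
  | nil => exact le_rfl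
  | cons a u ih =>
    have h₁ := encodeList_cons_append (enc := enc) a u []
    rw [List.append_nil, List.append_nil] at h₁
    have := List.length_pos_iff.2 (h a)
    rw [h₁, List.length_append, List.length_cons]
    omega

/-- The reader rests at the closing semicolon, so surplus rounds are harmless and the length of the
text can serve as their number. -/
theorem iterate_encodeList {f : List Symbol → List Symbol} {u : List α}
    (h : ∀ a ∈ u, ∀ y, f (enc a ++ y) = y) (h' : ∀ y, f (semicolon :: y) = semicolon :: y)
    (k : ℕ) (x : List Symbol) :
    f^[k] (encodeList enc u ++ x) = encodeList enc (u.drop k) ++ x := by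
  induction k generalizing u with
  | zero => rfl
  | succ k ih =>
    rw [Function.iterate_succ_apply]
    cases u with
    | nil => rw [encodeList_nil_append, h', List.drop_nil]; simpa using ih h
    | cons a u =>
      rw [encodeList_cons_append, h a List.mem_cons_self, List.drop_succ_cons]
      exact ih fun b hb => h b (List.mem_cons_of_mem _ hb)

/-- Failure is absorbing by `h₀`, and `[]` does not start with a semicolon; so arriving at a
semicolon certifies every element read before. -/
theorem iterate_sound {f : List Symbol → List Symbol} {p : α → Prop}
    (h₀ : f [] = []) (h₁ : ∀ l, AtEnd l → f l = l)
    (h : ∀ l, ¬AtEnd l → f l ≠ [] → ∃ a, p a ∧ l = enc a ++ f l) {k : ℕ} {l : List Symbol}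
    (hk : AtEnd (f^[k] l)) :
    ∃ u : List α, (∀ a ∈ u, p a) ∧ l = encodeList enc u ++ (f^[k] l).tail := by
  induction k generalizing l with
  | zero => exact ⟨[], by simp, by rw [encodeList_nil_append]; exact atEnd_iff.1 hk⟩
  | succ k ih =>
    rw [Function.iterate_succ_apply] at hk ⊢
    by_cases hl : AtEnd l
    · rw [h₁ l hl] at hk ⊢
      exact ih hk
    · have hne : f l ≠ [] := by
        intro h₂
        rw [h₂, Function.iterate_fixed h₀] at hk
        exact hk
      obtain ⟨a, ha, e⟩ := h l hl hne
      obtain ⟨u, hu, e'⟩ := ih hk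
      exact ⟨a :: u, List.forall_mem_cons.2 ⟨ha, hu⟩, by
        rw [encodeList_cons_append, ← e', ← e]⟩

end Lists

theorem encodeNat_ne_nil (m : ℕ) : encodeNat m ≠ [] := by simp [encodeNat]

theorem skipElem_encodeList {b : ℕ} (u : List (Fin b)) (k : ℕ) (x : List Symbol) :
    skipElem^[k] (encodeList encodeFin u ++ x) = encodeList encodeFin (u.drop k) ++ x :=
  iterate_encodeList (fun a _ y => by
      rw [encodeFin, skipElem, if_pos (more_encodeNat _ _), rst_encodeNat])
    (fun y => by rw [skipElem, if_neg (not_more_semicolon y)]) k x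

theorem readList_encodeList {b : ℕ} (u : List (Fin b)) (x : List Symbol) :
    readList b (encodeList encodeFin u ++ x) = x := by
  have h : (readElem b)^[(encodeList encodeFin u ++ x).length] (encodeList encodeFin u ++ x) =
      semicolon :: x := by
    rw [iterate_encodeList (fun a _ y => by
        rw [readElem, if_neg (show ¬AtEnd (encodeFin a ++ y) from
          not_atEnd_encodeNat _ _), readNum_encodeFin])
      (fun y => by rw [readElem, if_pos (atEnd_semicolon y)]), List.drop_eq_nil_of_le,
      encodeList_nil_append]
    have := length_le_length_encodeList (enc := @encodeFin b) (fun a => encodeNat_ne_nil a) u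
    rw [List.length_append]
    omega
  rw [readList, h, if_pos (atEnd_semicolon x), List.tail_cons]

theorem readList_sound {b : ℕ} {l : List Symbol} (h : readList b l ≠ []) :
    ∃ u : List (Fin b), l = encodeList encodeFin u ++ readList b l := by
  rw [readList] at h ⊢
  split_ifs at h ⊢ with h₁
  · obtain ⟨u, -, hu⟩ := iterate_sound (enc := @encodeFin b) (p := fun _ => True)
      (by rw [readElem, if_neg not_atEnd_nil, readNum_nil])
      (fun l hl => by rw [readElem, if_pos hl])
      (fun l hl h => by
        rw [readElem, if_neg hl] at h ⊢
        obtain ⟨i, hi⟩ := readNum_sound h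
        exact ⟨i, trivial, hi⟩) h₁
    exact ⟨u, hu⟩
  · exact absurd rfl h

theorem readList_nil (b : ℕ) : readList b [] = [] := if_neg not_atEnd_nil

section Rules

variable {n m g : ℕ}

@[simp] theorem fld_encodeTransition (t : Transition (Fin n) (Fin m) (Fin g)) (x : List Symbol) :
    fld (encodeTransition t ++ x) = t.src := by
  simp [encodeTransition, encodeFin]

@[simp] theorem fld_rst_encodeTransition (t : Transition (Fin n) (Fin m) (Fin g))
    (x : List Symbol) : fld (rst (encodeTransition t ++ x)) = t.letter := by
  simp [encodeTransition, encodeFin]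

@[simp] theorem fld_rst_rst_encodeTransition (t : Transition (Fin n) (Fin m) (Fin g))
    (x : List Symbol) : fld (rst (rst (encodeTransition t ++ x))) = t.top := by
  simp [encodeTransition, encodeFin]

@[simp] theorem fld_rst_rst_rst_encodeTransition (t : Transition (Fin n) (Fin m) (Fin g))
    (x : List Symbol) : fld (rst (rst (rst (encodeTransition t ++ x)))) = t.dst := by
  simp [encodeTransition, encodeFin]

theorem pushAt_encodeTransition (t : Transition (Fin n) (Fin m) (Fin g)) (x : List Symbol)
    (k : ℕ) : pushAt (encodeTransition t ++ x) k = encodeList encodeFin (t.push.drop k) ++ x := by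
  simp [encodeTransition, encodeFin, pushAt, skipElem_encodeList]

theorem more_encodeList {b : ℕ} (u : List (Fin b)) (x : List Symbol) :
    More (encodeList encodeFin u ++ x) ↔ u ≠ [] := by
  cases u <;> simp [encodeFin]

theorem length_push_lt (t : Transition (Fin n) (Fin m) (Fin g)) :
    t.push.length < (encodeTransition t).length := by
  have := length_le_length_encodeList (enc := @encodeFin g) (fun a => encodeNat_ne_nil a) t.push
  simp only [encodeTransition, List.length_append]
  omega

theorem pushesLast_encodeTransition (t : Transition (Fin n) (Fin m) (Fin g)) (x : List Symbol)
    (b : ℕ) : PushesLast b (encodeTransition t ++ x) ↔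
      ∃ (v : List (Fin g)) (c : Fin g), t.push = v ++ [c] ∧ (c : ℕ) = b := by
  simp only [PushesLast, pushAt_encodeTransition]
  constructor
  · rintro ⟨k, -, h₁, h₂, h₃⟩
    rcases h : t.push.drop k with _ | ⟨c, u⟩
    · rw [h] at h₁; simp at h₁
    · rw [h, encodeList_cons_append, encodeFin, fld_encodeNat] at h₂
      rw [h, encodeList_cons_append, encodeFin, rst_encodeNat] at h₃
      cases u with
      | nil => exact ⟨t.push.take k, c, by rw [← h, List.take_append_drop], h₂⟩
      | cons d u => rw [encodeList_cons_append] at h₃; exact absurd h₃ (not_atEnd_encodeNat _ _)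
  · rintro ⟨v, c, h, rfl⟩
    have := length_push_lt t
    refine ⟨v.length, ?_, ?_⟩
    · rw [h, List.length_append] at this
      rw [List.length_append]
      omega
    · rw [h, List.drop_left, encodeList_cons_append, encodeFin]
      simp

theorem encodeTransition_ne_nil (t : Transition (Fin n) (Fin m) (Fin g)) :
    encodeTransition t ≠ [] := List.length_pos_iff.1 ((Nat.zero_le _).trans_lt (length_push_lt t))

theorem encodeTransition_append (t : Transition (Fin n) (Fin m) (Fin g)) (x : List Symbol) :
    encodeTransition t ++ x = encodeFin t.src ++ (encodeFin t.letter ++ (encodeFin t.top ++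
      (encodeFin t.dst ++ (encodeList encodeFin t.push ++ x)))) := by
  simp [encodeTransition]

theorem not_atEnd_encodeTransition (t : Transition (Fin n) (Fin m) (Fin g)) (x : List Symbol) :
    ¬AtEnd (encodeTransition t ++ x) := by
  rw [encodeTransition_append]; exact not_atEnd_encodeNat _ _

theorem more_encodeTransition (t : Transition (Fin n) (Fin m) (Fin g)) (x : List Symbol) :
    More (encodeTransition t ++ x) := by
  rw [encodeTransition_append]; exact more_encodeNat _ _

/-- A transition that pops `b` pushes it back. -/
def KeepsBot (b : ℕ) (t : Transition (Fin n) (Fin m) (Fin g)) : Prop :=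
  (t.top : ℕ) = b → ∃ (v : List (Fin g)) (c : Fin g), t.push = v ++ [c] ∧ (c : ℕ) = b

theorem readRule_encodeTransition {b : ℕ} {t : Transition (Fin n) (Fin m) (Fin g)}
    (ht : KeepsBot b t) (x : List Symbol) : readRule n m g b (encodeTransition t ++ x) = x := by
  rw [readRule, if_neg (not_atEnd_encodeTransition t x), if_pos, encodeTransition_append,
    readNum_encodeFin, readNum_encodeFin, readNum_encodeFin, readNum_encodeFin,
    readList_encodeList]
  rwa [fld_rst_rst_encodeTransition, pushesLast_encodeTransition]

/-- All readers send `[]` to `[]`, so a nonempty final result shows that each of the five reads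
succeeded. -/
theorem readRule_sound {b : ℕ} {l : List Symbol} (h : ¬AtEnd l) (h' : readRule n m g b l ≠ []) :
    ∃ t : Transition (Fin n) (Fin m) (Fin g), KeepsBot b t ∧
      l = encodeTransition t ++ readRule n m g b l := by
  rw [readRule, if_neg h] at h' ⊢
  split_ifs at h' ⊢ with hb
  · have h₅ := h'
    obtain ⟨p, e₅⟩ := readList_sound h₅
    have h₄ : readNum n (readNum g (readNum m (readNum n l))) ≠ [] := fun e =>
      h₅ (by rw [e, readList_nil])
    obtain ⟨q, e₄⟩ := readNum_sound h₄
    have h₃ : readNum g (readNum m (readNum n l)) ≠ [] := fun e => h₄ (by rw [e, readNum_nil])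
    obtain ⟨X, e₃⟩ := readNum_sound h₃
    have h₂ : readNum m (readNum n l) ≠ [] := fun e => h₃ (by rw [e, readNum_nil])
    obtain ⟨a, e₂⟩ := readNum_sound h₂
    have h₁ : readNum n l ≠ [] := fun e => h₂ (by rw [e, readNum_nil])
    obtain ⟨s, e₁⟩ := readNum_sound h₁
    have e : l = encodeTransition ⟨s, a, X, q, p⟩ ++
        readList g (readNum n (readNum g (readNum m (readNum n l)))) := by
      rw [encodeTransition_append, ← e₅, ← e₄, ← e₃, ← e₂, ← e₁]
    refine ⟨_, ?_, e⟩
    rw [e, fld_rst_rst_encodeTransition, pushesLast_encodeTransition] at hb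
    exact hb
  · exact absurd rfl h'

theorem readRule_iterate {b : ℕ} {u : List (Transition (Fin n) (Fin m) (Fin g))}
    (hu : ∀ t ∈ u, KeepsBot b t) (k : ℕ) (x : List Symbol) :
    (readRule n m g b)^[k] (encodeList encodeTransition u ++ x) =
      encodeList encodeTransition (u.drop k) ++ x :=
  iterate_encodeList (fun t ht => readRule_encodeTransition (hu t ht))
    (fun y => by rw [readRule, if_pos (atEnd_semicolon y)]) k x

theorem readRule_iterate_sound {b k : ℕ} {l : List Symbol}
    (h : AtEnd ((readRule n m g b)^[k] l)) :
    ∃ u : List (Transition (Fin n) (Fin m) (Fin g)), (∀ t ∈ u, KeepsBot b t) ∧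
      l = encodeList encodeTransition u ++ ((readRule n m g b)^[k] l).tail :=
  iterate_sound (by
      rw [readRule, if_neg not_atEnd_nil, readNum_nil, readNum_nil, readNum_nil, readNum_nil,
        readList_nil, ite_self])
    (fun l hl => by rw [readRule, if_pos hl]) (fun l => readRule_sound) h

end Rules

namespace Instance

variable (x : Instance)

theorem keepsBot : ∀ t ∈ x.rules, KeepsBot x.bot t := by
  intro t ht h
  obtain ⟨v, hv⟩ := x.bot_push t ht (Fin.ext h)
  exact ⟨v, x.bot, hv, rfl⟩

@[simp] theorem numStatesOf_encode : numStatesOf x.encode = x.numStates := by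
  simp [numStatesOf, encode]

@[simp] theorem numLettersOf_encode : numLettersOf x.encode = x.numLetters := by
  simp [numLettersOf, encode]

@[simp] theorem numStackOf_encode : numStackOf x.encode = x.numStack := by
  simp [numStackOf, encode]

@[simp] theorem botOf_encode : botOf x.encode = x.bot := by
  simp [botOf, encode, encodeFin]

@[simp] theorem targetOf_encode : targetOf x.encode = x.target := by
  simp [targetOf, encode, encodeFin]

theorem initialText_encode : initialText x.encode =
    encodeList encodeFin x.initial ++ encodeList encodeTransition x.rules := by
  simp [initialText, encode, encodeFin]

theorem rulesText_encode : rulesText x.encode = encodeList encodeTransition x.rules := by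
  rw [rulesText, numStatesOf_encode, numStackOf_encode, encode, rst_encodeNat, rst_encodeNat,
    rst_encodeNat, readNum_encodeFin, readNum_encodeFin, readList_encodeList]

theorem ruleAt_encode (j : ℕ) :
    ruleAt x.encode j = encodeList encodeTransition (x.rules.drop j) := by
  rw [ruleAt, numStatesOf_encode, numLettersOf_encode, numStackOf_encode, botOf_encode,
    rulesText_encode]
  simpa using readRule_iterate x.keepsBot j []

/-- The algorithm searches up to the length of the text; this bound and its companions show that
such searches miss nothing. -/
theorem length_rules_lt : x.rules.length < x.encode.length := by
  have := length_le_length_encodeList encodeTransition_ne_nil x.rules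
  simp only [encode, List.length_append]
  omega

theorem length_initial_lt : x.initial.length < x.encode.length := by
  have := length_le_length_encodeList (enc := @encodeFin x.numStates)
    (fun a => encodeNat_ne_nil a) x.initial
  simp only [encode, List.length_append]
  omega

theorem numStates_lt : x.numStates < x.encode.length := by
  simp only [encode, List.length_append, length_encodeNat]
  omega

theorem length_push_lt_length_encode {t : Transition _ _ _} (ht : t ∈ x.rules) :
    t.push.length < x.encode.length := by
  have h₁ := length_push_lt t
  have h₂ : (encodeTransition t).length ≤ (encodeList encodeTransition x.rules).length := by
    rw [encodeList, List.length_append, List.length_flatMap]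
    exact (List.single_le_sum (fun _ _ => Nat.zero_le _) _ (List.mem_map_of_mem
      (f := fun a => (encodeTransition a).length) ht)).trans
      (Nat.le_add_right _ _)
  simp only [encode, List.length_append]
  omega

theorem valid_encode : Valid x.encode := by
  refine ⟨?_, ?_⟩
  · simp [encode]
  · rw [ruleAt_encode, List.drop_eq_nil_of_le x.length_rules_lt.le]
    exact ⟨atEnd_semicolon [], rfl⟩

end Instance

theorem valid_iff {w : List Symbol} : Valid w ↔ ∃ x : Instance, x.encode = w := by
  constructor
  · rintro ⟨⟨h₁, h₂, h₃⟩, h₄, h₅⟩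
    obtain ⟨u, hu, e⟩ := readRule_iterate_sound h₄
    -- Only the closing semicolon is left, so nothing follows the list of transitions.
    have e' : (ruleAt w w.length).tail = [] := List.length_eq_zero_iff.1 (by
      rw [List.length_tail, h₅])
    rw [ruleAt] at e'
    rw [e', List.append_nil] at e
    have hr : rulesText w ≠ [] := by
      rw [e]; simp [encodeList]
    rw [rulesText] at hr e
    obtain ⟨i, e₆⟩ := readList_sound hr
    have h₆ : readNum (numStatesOf w) (readNum (numStackOf w) (rst (rst (rst w)))) ≠ [] :=
      fun h => hr (by rw [h, readList_nil])
    obtain ⟨s, e₇⟩ := readNum_sound h₆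
    have h₇ : readNum (numStackOf w) (rst (rst (rst w))) ≠ [] :=
      fun h => h₆ (by rw [h, readNum_nil])
    obtain ⟨b, e₈⟩ := readNum_sound h₇
    have hb : botOf w = b := by rw [botOf, e₈, encodeFin, fld_encodeNat]
    refine ⟨⟨numStatesOf w, numLettersOf w, numStackOf w, b, u, ?_, i, s⟩, ?_⟩
    · intro t ht h
      obtain ⟨v, c, hv, hc⟩ := hu t ht (by rw [hb, h])
      exact ⟨v, by rw [hv, Fin.ext (hc.trans hb)]⟩
    · rw [Instance.encode, ← e, ← e₆, ← e₇, ← e₈]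
      exact (h₁.eq.trans (congrArg _ (h₂.eq.trans (congrArg _ h₃.eq)))).symm
  · rintro ⟨x, rfl⟩
    exact x.valid_encode

end AdaptiveSync

/-! ### Binary codes of sets and families, and correctness of the table. -/

namespace AdaptiveSync

/-! ### Sets and families as numbers -/

/-- The number of a set of states. -/
def encSet {n : ℕ} (S : Finset (Fin n)) : ℕ := Nat.ofBits fun i => decide (i ∈ S)

open Classical in
/-- The number of a family of sets of states. -/
noncomputable def encFam {n : ℕ} (F : Set (Finset (Fin n))) : ℕ :=
  Nat.ofBits (n := 2 ^ n) fun i => decide (∃ S ∈ F, encSet S = i)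

section Numbers

variable {n : ℕ}

theorem encSet_lt (S : Finset (Fin n)) : encSet S < 2 ^ n := Nat.ofBits_lt_two_pow _

theorem encFam_lt (F : Set (Finset (Fin n))) : encFam F < 2 ^ 2 ^ n := Nat.ofBits_lt_two_pow _

@[simp] theorem testBit_encSet (S : Finset (Fin n)) (q : Fin n) :
    (encSet S).testBit q = true ↔ q ∈ S := by
  rw [encSet, Nat.testBit_ofBits_lt _ _ q.2]
  simp

theorem eq_of_testBit {k x y : ℕ} (hx : x < 2 ^ k) (hy : y < 2 ^ k)
    (h : ∀ i < k, (x.testBit i = true ↔ y.testBit i = true)) : x = y := by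
  refine Nat.eq_of_testBit_eq fun i => ?_
  rcases lt_or_ge i k with hi | hi
  · exact Bool.eq_iff_iff.2 (h i hi)
  · rw [Nat.testBit_lt_two_pow (hx.trans_le (Nat.pow_le_pow_right (by omega) hi)),
      Nat.testBit_lt_two_pow (hy.trans_le (Nat.pow_le_pow_right (by omega) hi))]

theorem eq_encSet {z : ℕ} {S : Finset (Fin n)} (hz : z < 2 ^ n)
    (h : ∀ q : Fin n, z.testBit q = true ↔ q ∈ S) : z = encSet S :=
  eq_of_testBit hz (encSet_lt S) fun i hi => (h ⟨i, hi⟩).trans (testBit_encSet S ⟨i, hi⟩).symm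

theorem encSet_injective : Function.Injective (encSet (n := n)) := fun S S' h => by
  ext q
  rw [← testBit_encSet, h, testBit_encSet]

theorem exists_encSet {z : ℕ} (hz : z < 2 ^ n) : ∃ S : Finset (Fin n), encSet S = z :=
  ⟨Finset.univ.filter fun q : Fin n => z.testBit q = true, (eq_encSet hz fun q => by simp).symm⟩

@[simp] theorem testBit_encFam (F : Set (Finset (Fin n))) (S : Finset (Fin n)) :
    (encFam F).testBit (encSet S) = true ↔ S ∈ F := by
  rw [encFam, Nat.testBit_ofBits_lt _ _ (encSet_lt S)]
  simp [encSet_injective.eq_iff]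

theorem eq_encFam {z : ℕ} {F : Set (Finset (Fin n))} (hz : z < 2 ^ 2 ^ n)
    (h : ∀ S, z.testBit (encSet S) = true ↔ S ∈ F) : z = encFam F := by
  refine eq_of_testBit hz (encFam_lt F) fun i hi => ?_
  obtain ⟨S, rfl⟩ := exists_encSet hi
  rw [h, testBit_encFam]

theorem encFam_injective : Function.Injective (encFam (n := n)) := fun F F' h => by
  ext S
  rw [← testBit_encFam, h, testBit_encFam]

theorem exists_encFam {z : ℕ} (hz : z < 2 ^ 2 ^ n) : ∃ F : Set (Finset (Fin n)), encFam F = z :=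
  ⟨{S | z.testBit (encSet S) = true}, (eq_encFam hz fun _ => Iff.rfl).symm⟩

theorem encSet_empty : encSet (∅ : Finset (Fin n)) = 0 :=
  (eq_encSet (Nat.two_pow_pos n) (by simp)).symm

/-- The empty set has number `0`, so this family is `2 ^ 0`. It explains the constant `1` in
`Accepts`, just as bit `0` in `Derives` stands for `∅ ∈ F`. -/
theorem encFam_singleton_empty : encFam {(∅ : Finset (Fin n))} = 1 := by
  refine (eq_encFam (Nat.one_lt_two_pow (Nat.two_pow_pos n).ne') fun S => ?_).symm
  rw [Set.mem_singleton_iff, ← encSet_injective.eq_iff, encSet_empty]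
  cases encSet S <;> simp [Nat.testBit_succ]

/-- Uniqueness of digits in a mixed radix; it makes table indices determine their triples. -/
theorem mul_add_inj {k a a' s s' : ℕ} (hs : s < k) (hs' : s' < k)
    (h : a * k + s = a' * k + s') : a = a' ∧ s = s' := by
  have h₁ : (a * k + s) % k = s := by
    rw [Nat.mul_comm, Nat.mul_add_mod, Nat.mod_eq_of_lt hs]
  have h₂ : (a' * k + s') % k = s' := by
    rw [Nat.mul_comm, Nat.mul_add_mod, Nat.mod_eq_of_lt hs']
  have h₃ : s = s' := by rw [← h₁, h, h₂]
  subst h₃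
  exact ⟨Nat.eq_of_mul_eq_mul_right (by omega) (Nat.add_right_cancel h), rfl⟩

theorem mul_add_lt {k a b s : ℕ} (hs : s < k) (ha : a < b) : a * k + s < b * k := by
  have := Nat.mul_le_mul_right k (Nat.succ_le_of_lt ha)
  rw [Nat.succ_mul] at this
  omega

end Numbers

/-! ### Correctness of the saturation algorithm -/

namespace Instance

variable (x : Instance) {D M : ℕ}

/-- The transition relation of an instance on words. -/
abbrev Trans : Type := Transition (Fin x.numStates) (Fin x.numLetters) (Fin x.numStack)

/-- Turns a search over text positions into one over transitions. Positions past the last transition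
fail `More`; at the others the transition is followed by an irrelevant rest, hence the arbitrary
`y`. -/
theorem exists_rule_iff {φ : List Symbol → Prop} {ψ : x.Trans → Prop}
    (h : ∀ t ∈ x.rules, ∀ y, φ (encodeTransition t ++ y) ↔ ψ t) :
    (∃ j < x.encode.length, More (ruleAt x.encode j) ∧ φ (ruleAt x.encode j)) ↔
      ∃ t ∈ x.rules, ψ t := by
  constructor
  · rintro ⟨j, -, h₁, h₂⟩
    rw [ruleAt_encode] at h₁ h₂
    rcases e : x.rules.drop j with _ | ⟨t, u⟩
    · rw [e] at h₁
      exact absurd h₁ (not_more_semicolon [])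
    · have ht : t ∈ x.rules := List.mem_of_mem_drop (e ▸ List.mem_cons_self)
      have e' := encodeList_cons_append (enc := encodeTransition) t u []
      rw [List.append_nil, List.append_nil] at e'
      rw [e, e', h t ht] at h₂
      exact ⟨t, ht, h₂⟩
  · rintro ⟨t, ht, h₁⟩
    obtain ⟨u, v, e⟩ := List.append_of_mem ht
    have e' := encodeList_cons_append (enc := encodeTransition) t v []
    rw [List.append_nil, List.append_nil] at e'
    have e₁ : ruleAt x.encode u.length =
        encodeTransition t ++ encodeList encodeTransition v := by
      rw [ruleAt_encode, e, List.drop_left, e']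
    refine ⟨u.length, ?_, ?_⟩
    · have := x.length_rules_lt
      rw [e, List.length_append] at this
      omega
    · rw [e₁, h t ht]
      exact ⟨more_encodeTransition _ _, h₁⟩

theorem forall_rule_iff {φ : List Symbol → Prop} {ψ : x.Trans → Prop}
    (h : ∀ t ∈ x.rules, ∀ y, φ (encodeTransition t ++ y) ↔ ψ t) :
    (∀ j < x.encode.length, More (ruleAt x.encode j) → φ (ruleAt x.encode j)) ↔
      ∀ t ∈ x.rules, ψ t := by
  have := not_congr (x.exists_rule_iff (φ := fun l => ¬φ l) (ψ := fun t => ¬ψ t)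
    fun t ht y => not_congr (h t ht y))
  simpa using this

theorem match_iff {S : Finset (Fin x.numStates)} {X : Fin x.numStack} {a : Fin x.numLetters}
    (t : x.Trans) (y : List Symbol) : Match (encSet S) X a (encodeTransition t ++ y) ↔
      t.src ∈ S ∧ t.letter = a ∧ t.top = X := by
  simp [Match, Fin.ext_iff]

theorem mem_possible {S : Finset (Fin x.numStates)} {X : Fin x.numStack}
    {a : Fin x.numLetters} {t : x.Trans} :
    t ∈ x.pda.possible S X a ↔ t ∈ x.rules ∧ t.src ∈ S ∧ t.letter = a ∧ t.top = X := by
  simp [PDA.possible, pda]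

/-- The first symbols of all suffixes are compared. The length of the text bounds both pushed words,
and the clause on `More` detects different lengths. -/
theorem samePush_iff {t t' : x.Trans} (ht : t ∈ x.rules) (ht' : t' ∈ x.rules)
    (y y' : List Symbol) : SamePush x.encode.length (encodeTransition t ++ y)
      (encodeTransition t' ++ y') ↔ t'.push = t.push := by
  have key : ∀ (n : ℕ) (u u' : List (Fin x.numStack)), u.length ≤ n → u'.length ≤ n →
      (∀ k < n, (u.drop k ≠ [] ↔ u'.drop k ≠ []) ∧ (u.drop k ≠ [] →
        fld (encodeList encodeFin (u.drop k) ++ y) =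
          fld (encodeList encodeFin (u'.drop k) ++ y'))) → u' = u := by
    intro n
    induction n with
    | zero =>
      intro u u' hu hu' _
      rw [List.length_eq_zero_iff.1 (Nat.le_zero.1 hu),
        List.length_eq_zero_iff.1 (Nat.le_zero.1 hu')]
    | succ n ih =>
      intro u u' hu hu' h
      obtain ⟨h₁, h₂⟩ := h 0 (Nat.succ_pos n)
      rcases u with _ | ⟨c, u⟩
      · rcases u' with _ | ⟨c', u'⟩
        · rfl
        · simp at h₁
      · rcases u' with _ | ⟨c', u'⟩
        · simp at h₁
        · have h₃ := h₂ (by simp)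
          rw [List.drop_zero, List.drop_zero, encodeList_cons_append, encodeList_cons_append,
            encodeFin, encodeFin, fld_encodeNat, fld_encodeNat] at h₃
          rw [Fin.ext h₃, ih u u' (by simpa using hu) (by simpa using hu') fun k hk => by
            simpa using h (k + 1) (by omega)]
  simp only [SamePush, pushAt_encodeTransition, more_encodeList]
  constructor
  · exact key _ _ _ (x.length_push_lt_length_encode ht).le
      (x.length_push_lt_length_encode ht').le
  · intro h k _
    rw [h]
    refine ⟨Iff.rfl, fun h => ?_⟩
    rcases e : t.push.drop k with _ | ⟨c, u⟩
    · exact absurd e h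
    · rw [encodeList_cons_append, encodeList_cons_append, encodeFin, fld_encodeNat,
        fld_encodeNat]

/-- A bound on the number of sets of states. -/
abbrev setBound : ℕ := 2 ^ x.encode.length

/-- A bound on the number of families of sets of states. -/
abbrev famBound : ℕ := 2 ^ x.setBound

theorem pow_numStates_le : 2 ^ x.numStates ≤ x.setBound :=
  Nat.pow_le_pow_right (by omega) x.numStates_lt.le

theorem pow_pow_numStates_le : 2 ^ 2 ^ x.numStates ≤ x.famBound :=
  Nat.pow_le_pow_right (by omega) x.pow_numStates_le

@[simp] theorem numSets_encode : numSets x.encode x.setBound = 2 ^ x.numStates := by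
  rw [numSets, numStatesOf_encode, powTwo_eq x.pow_numStates_le]

@[simp] theorem numFamilies_encode :
    numFamilies x.encode x.setBound x.famBound = 2 ^ 2 ^ x.numStates := by
  rw [numFamilies, numSets_encode, powTwo_eq x.pow_pow_numStates_le]

/-- The index of a triple. -/
noncomputable abbrev idx (S : Finset (Fin x.numStates)) (X : Fin x.numStack)
    (F : Set (Finset (Fin x.numStates))) : ℕ :=
  index x.encode x.setBound (encSet S) X (encFam F)

theorem idx_lt (S : Finset (Fin x.numStates)) (X : Fin x.numStack)
    (F : Set (Finset (Fin x.numStates))) :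
    x.idx S X F < tableSize x.encode x.setBound x.famBound := by
  rw [idx, index, tableSize, numSets_encode, numFamilies_encode, numStackOf_encode]
  exact mul_add_lt (encSet_lt S) (mul_add_lt X.2 (encFam_lt F))

theorem idx_inj {S S' : Finset (Fin x.numStates)} {X X' : Fin x.numStack}
    {F F' : Set (Finset (Fin x.numStates))} (h : x.idx S X F = x.idx S' X' F') :
    S = S' ∧ X = X' ∧ F = F' := by
  rw [idx, idx, index, index, numSets_encode, numStackOf_encode] at h
  obtain ⟨h₁, h₂⟩ := mul_add_inj (encSet_lt S) (encSet_lt S') h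
  obtain ⟨h₃, h₄⟩ := mul_add_inj X.2 X'.2 h₁
  exact ⟨encSet_injective h₂, Fin.ext h₄, encFam_injective h₃⟩

/-- A table holds a relation. -/
def Holds (T : List Symbol) (R : Rel (Fin x.numStates) (Fin x.numStack)) : Prop :=
  ∀ S X F, lookup T (x.idx S X F) ↔ R S X F

variable {x} {T : List Symbol} {R : Rel (Fin x.numStates) (Fin x.numStack)}

theorem Holds.preNum_eq (h : x.Holds T R) (X : Fin x.numStack)
    (F : Set (Finset (Fin x.numStates))) :
    preNum x.encode x.setBound x.famBound T X (encFam F) = encFam {S | R S X F} := by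
  rw [preNum, numSets_encode]
  obtain ⟨h₁, h₂⟩ := bitsNum_spec (fun S => lookup T (index x.encode x.setBound S X (encFam F)))
    x.pow_pow_numStates_le
  exact eq_encFam h₁ fun S => (h₂ _ (encSet_lt S)).trans (h S X F)

theorem Holds.backNum_eq (h : x.Holds T R) {t : x.Trans} (ht : t ∈ x.rules) (y : List Symbol)
    (F : Set (Finset (Fin x.numStates))) :
    backNum x.encode x.setBound x.famBound T (encFam F) (encodeTransition t ++ y) =
      encFam (R.back t.push F) := by
  have hlen := x.length_push_lt_length_encode ht
  rw [backNum]
  set n := x.encode.length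
  -- The loop visits positions from the last to the first, as `foldr` does: after `i` rounds the
  -- suffix from `n - i` is processed, and positions beyond the word leave the family unchanged.
  have key : ∀ i ≤ n, iter (fun i v => open Classical in
      if More (pushAt (encodeTransition t ++ y) (n - 1 - i)) then
        preNum x.encode x.setBound x.famBound T
          (fld (pushAt (encodeTransition t ++ y) (n - 1 - i))) v else v) (encFam F) i =
      encFam (R.back (t.push.drop (n - i)) F) := by
    intro i
    induction i with
    | zero => intro _; rw [List.drop_eq_nil_of_le (by omega)]; rfl
    | succ i ih =>
      intro hi
      rw [iter, ih (by omega), pushAt_encodeTransition]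
      simp only [more_encodeList]
      have e : n - i = n - 1 - i + 1 := by omega
      have e' : n - (i + 1) = n - 1 - i := by omega
      rw [e, e', ← List.tail_drop]
      rcases t.push.drop (n - 1 - i) with _ | ⟨X, u⟩
      · simp
      · rw [if_pos (List.cons_ne_nil X u), encodeList_cons_append, encodeFin, fld_encodeNat,
          List.tail_cons, h.preNum_eq]
        rfl
  have := key n le_rfl
  rwa [Nat.sub_self, List.drop_zero] at this

theorem nextNum_eq {S : Finset (Fin x.numStates)} {X : Fin x.numStack} {a : Fin x.numLetters}
    {t : x.Trans} (ht : t ∈ x.rules) (y : List Symbol) :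
    nextNum x.encode x.setBound (encSet S) X a (encodeTransition t ++ y) =
      encSet ((x.pda.indistClass S X a t).image Transition.dst) := by
  rw [nextNum, numStatesOf_encode]
  obtain ⟨h₁, h₂⟩ := bitsNum_spec (fun q => ∃ j < x.encode.length, More (ruleAt x.encode j) ∧
    Match (encSet S) X a (ruleAt x.encode j) ∧
      SamePush x.encode.length (encodeTransition t ++ y) (ruleAt x.encode j) ∧
        fld (rst (rst (rst (ruleAt x.encode j)))) = q) x.pow_numStates_le
  refine eq_encSet h₁ fun q => (h₂ q q.2).trans ?_
  rw [x.exists_rule_iff (φ := fun l => Match (encSet S) X a l ∧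
    SamePush x.encode.length (encodeTransition t ++ y) l ∧ fld (rst (rst (rst l))) = q)
    (ψ := fun t' => (t'.src ∈ S ∧ t'.letter = a ∧ t'.top = X) ∧ t'.push = t.push ∧ t'.dst = q)
    fun t' ht' y' => by
      rw [match_iff, x.samePush_iff ht ht', fld_rst_rst_rst_encodeTransition,
        Fin.ext_iff (a := t'.dst)]]
  simp only [Finset.mem_image, PDA.indistClass, Finset.mem_filter, mem_possible, and_assoc]

/-- A letter that allows some move is the letter of a transition, so the program can range over
transitions in place of letters. -/
theorem Holds.derives_iff (h : x.Holds T R) (S : Finset (Fin x.numStates)) (X : Fin x.numStack)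
    (F : Set (Finset (Fin x.numStates))) :
    Derives x.encode x.setBound x.famBound T (encSet S) X (encFam F) ↔
      x.pda.saturate x.target R S X F := by
  have h₁ : ((X : ℕ) = botOf x.encode ∧ (∀ q < numStatesOf x.encode,
      ((encSet S).testBit q = true ↔ q = targetOf x.encode)) ∧ (encFam F).testBit 0 = true) ↔
      (X = x.bot ∧ S = {x.target} ∧ ∅ ∈ F) := by
    rw [botOf_encode, Fin.ext_iff, numStatesOf_encode, targetOf_encode, ← testBit_encFam,
      encSet_empty, Finset.ext_iff]
    refine and_congr_right fun _ => and_congr_left fun _ => ?_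
    constructor
    · intro hq q
      rw [Finset.mem_singleton, Fin.ext_iff, ← hq q q.2, testBit_encSet]
    · intro hq q hq'
      have := hq ⟨q, hq'⟩
      rw [Finset.mem_singleton, Fin.ext_iff, ← testBit_encSet] at this
      exact this
  refine or_congr h₁ ?_
  rw [x.exists_rule_iff (φ := fun l => Match (encSet S) X (fld (rst l)) l ∧
    ∀ i < x.encode.length, More (ruleAt x.encode i) →
      Match (encSet S) X (fld (rst l)) (ruleAt x.encode i) →
        (backNum x.encode x.setBound x.famBound T (encFam F) (ruleAt x.encode i)).testBit
          (nextNum x.encode x.setBound (encSet S) X (fld (rst l)) (ruleAt x.encode i)) = true)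
    (ψ := fun t => (t.src ∈ S ∧ t.top = X) ∧ ∀ t' ∈ x.pda.possible S X t.letter,
      (x.pda.indistClass S X t.letter t').image Transition.dst ∈ R.back t'.push F)]
  · constructor
    · rintro ⟨t, ht, ⟨h₁, h₂⟩, h₃⟩
      exact ⟨t.letter, ⟨t, x.mem_possible.2 ⟨ht, h₁, rfl, h₂⟩⟩, h₃⟩
    · rintro ⟨a, ⟨t, ht⟩, h₃⟩
      obtain ⟨h₁, h₂, rfl, h₄⟩ := x.mem_possible.1 ht
      exact ⟨t, h₁, ⟨h₂, h₄⟩, h₃⟩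
  · intro t ht y
    rw [fld_rst_encodeTransition, match_iff]
    refine and_congr (by tauto) ?_
    rw [x.forall_rule_iff (φ := fun l => Match (encSet S) X t.letter l →
        (backNum x.encode x.setBound x.famBound T (encFam F) l).testBit
          (nextNum x.encode x.setBound (encSet S) X t.letter l) = true)
      (ψ := fun t' => (t'.src ∈ S ∧ t'.letter = t.letter ∧ t'.top = X) →
        (x.pda.indistClass S X t.letter t').image Transition.dst ∈ R.back t'.push F)]
    · simp only [mem_possible, and_imp]
    · intro t' ht' y'
      rw [match_iff, h.backNum_eq ht', nextNum_eq ht', testBit_encFam]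

theorem Holds.saturate (h : x.Holds T R) :
    x.Holds (saturate x.encode x.setBound x.famBound T) (x.pda.saturate x.target R) := by
  intro S X F
  rw [AdaptiveSync.saturate, lookup_table, ← h.derives_iff, numSets_encode, numFamilies_encode,
    numStackOf_encode]
  constructor
  · rintro ⟨-, S', hS', X', hX', F', hF', e, hd⟩
    obtain ⟨S', rfl⟩ := exists_encSet hS'
    obtain ⟨F', rfl⟩ := exists_encFam hF'
    obtain ⟨rfl, rfl, rfl⟩ := x.idx_inj (X' := ⟨X', hX'⟩) e
    exact hd
  · intro hd
    exact ⟨x.idx_lt S X F, _, encSet_lt S, X, X.2, _, encFam_lt F, rfl, hd⟩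

theorem holds_iterate (i : ℕ) :
    x.Holds ((AdaptiveSync.saturate x.encode x.setBound x.famBound)^[i] [])
    (x.pda.round x.target i) := by
  induction i with
  | zero => exact fun S X F => iff_of_false (fun h => absurd h.1 (Nat.not_lt_zero _)) id
  | succ i ih =>
    rw [PDA.round_succ, Function.iterate_succ_apply']
    exact ih.saturate

variable (x)

theorem initialNum_eq : initialNum x.encode x.setBound = encSet x.initial.toFinset := by
  rw [initialNum, numStatesOf_encode]
  obtain ⟨h₁, h₂⟩ := bitsNum_spec (fun q => ∃ k < x.encode.length,
    More (skipElem^[k] (initialText x.encode)) ∧ fld (skipElem^[k] (initialText x.encode)) = q)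
      x.pow_numStates_le
  refine eq_encSet h₁ fun q => (h₂ q q.2).trans ?_
  simp only [initialText_encode, skipElem_encodeList, more_encodeList, List.mem_toFinset]
  constructor
  · rintro ⟨k, -, h₃, h₄⟩
    rcases e : x.initial.drop k with _ | ⟨c, u⟩
    · exact absurd e h₃
    · rw [e, encodeList_cons_append, encodeFin, fld_encodeNat] at h₄
      rw [← Fin.ext h₄]
      exact List.mem_of_mem_drop (e ▸ List.mem_cons_self)
  · intro hq
    obtain ⟨u, v, e⟩ := List.append_of_mem hq
    have := x.length_initial_lt
    rw [e, List.length_append] at this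
    refine ⟨u.length, by omega, ?_⟩
    rw [e, List.drop_left, encodeList_cons_append, encodeFin, fld_encodeNat]
    exact ⟨List.cons_ne_nil _ _, rfl⟩

theorem accepts_iff : Accepts x.encode x.setBound x.famBound ↔ x.IsPositive := by
  rw [Accepts, and_iff_right x.valid_encode, initialNum_eq, botOf_encode,
    ← encFam_singleton_empty (n := x.numStates), IsPositive, exists_superSynchroniser_iff_round]
  · exact holds_iterate _ _ _ _
  -- The table has one entry per triple, so running `tableSize` rounds is enough to reach the fixed
  -- point.
  · have e : Nat.card (Set (Finset (Fin x.numStates))) = 2 ^ 2 ^ x.numStates := by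
      rw [Nat.card_eq_fintype_card, Fintype.card_set, Fintype.card_finset, Fintype.card_fin]
    rw [Nat.card_prod, Nat.card_prod, e, Nat.card_eq_fintype_card, Fintype.card_finset,
      Fintype.card_fin, Nat.card_fin, tableSize, numSets_encode, numFamilies_encode,
      numStackOf_encode]
    exact le_of_eq (by ring)

end Instance

theorem accepts_iff_mem (w : List Symbol) :
    Accepts w (2 ^ w.length) (2 ^ 2 ^ w.length) ↔ w ∈ specialSync := by
  constructor
  · intro h
    obtain ⟨x, rfl⟩ := valid_iff.1 h.1
    exact ⟨x, rfl, x.accepts_iff.1 h⟩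
  · rintro ⟨x, rfl, hx⟩
    exact x.accepts_iff.2 hx

/-! ### The decision procedure -/

/-- Doubling, as many times as the first argument is long. -/
def doubling : Code :=
  .loop (.arg 0) (.cons .tally .nil)
    (.loop (.arg 1) (.arg 1) (.cons .tally (.arg 1)))

theorem iter_cons_tally (j m : ℕ) (e : List (List Symbol)) : iter (fun i v =>
    (Code.cons .tally (.arg 1)).eval (tallies i :: v :: e)) (tallies m) j = tallies (m + j) := by
  induction j with
  | zero => rfl
  | succ j ih => rw [iter, ih]; rfl

theorem eval_doubling_step (n : ℕ) (e : List (List Symbol)) :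
    (Code.loop (.arg 1) (.arg 1) (.cons .tally (.arg 1))).eval (tallies n :: tallies (2 ^ n) :: e) =
      tallies (2 ^ (n + 1)) := by
  refine (iter_cons_tally _ _ _).trans ?_
  simp only [Code.eval, List.getD_cons_succ, List.getD_cons_zero, List.length_replicate]
  rw [pow_succ, mul_two]

theorem iter_doubling (n : ℕ) (e : List (List Symbol)) : iter (fun i v =>
    (Code.loop (.arg 1) (.arg 1) (.cons .tally (.arg 1))).eval (tallies i :: v :: e))
      ((Code.cons .tally .nil).eval e) n = tallies (2 ^ n) := by
  induction n with
  | zero => rfl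
  | succ n ih => rw [iter, ih, eval_doubling_step]

theorem eval_doubling (l : List Symbol) (e : List (List Symbol)) :
    doubling.eval (l :: e) = tallies (2 ^ l.length) :=
  iter_doubling _ _

/-- Round `i` builds words of length at most `2 ^ (i + 1)`, and `i` is below the length of `l`. -/
theorem fits_doubling (l : List Symbol) (e : List (List Symbol)) :
    doubling.Fits (2 ^ l.length) (l :: e) := by
  refine ⟨trivial, ⟨trivial, Nat.one_le_two_pow⟩, fun i hi => ?_⟩
  rw [iter_doubling]
  refine ⟨trivial, trivial, fun j hj => ⟨trivial, ?_⟩⟩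
  have h₁ := iter_cons_tally j (2 ^ i) (tallies i :: tallies (2 ^ i) :: l :: e)
  have h₂ : j < 2 ^ i := by simpa [Code.eval] using hj
  have h₃ : 2 ^ (i + 1) ≤ 2 ^ l.length := Nat.pow_le_pow_right (by omega) hi
  rw [pow_succ] at h₃
  have h₄ : (iter (fun i' v => (Code.cons .tally (.arg 1)).eval
      (tallies i' :: v :: tallies i :: tallies (2 ^ i) :: l :: e)) (tallies (2 ^ i)) j).length =
        2 ^ i + j := by rw [h₁, List.length_replicate]
  refine le_trans (Nat.succ_le_succ h₄.le) ?_
  omega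

theorem specialSync_mem_twoEXPTIME : specialSync ∈ TwoEXPTIME Symbol := by
  classical
  -- The two exponential bounds enter as unary variables, because `Feas` admits only polynomial
  -- growth; measured against the larger one, the whole algorithm is polynomial.
  obtain ⟨c, k, hc⟩ := Feas.accepts (Γ := ((Unit × List Symbol) × ℕ) × ℕ)
    (w := fun p => p.1.1.2) (D := fun p => p.1.2) (M := fun p => p.2) Feas.snd.wk.wk
    Feas.snd.wk Feas.snd
  have hlt : ∀ n, n ≤ 2 ^ n := fun n => Nat.lt_two_pow_self.le
  have hw : ∀ w : List Symbol, c.eval [tallies (2 ^ 2 ^ w.length), tallies (2 ^ w.length), w] =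
      Rep.rep (Accepts w (2 ^ w.length) (2 ^ 2 ^ w.length)) ∧
      c.Fits ((2 ^ 2 ^ w.length + 2) ^ k)
        [tallies (2 ^ 2 ^ w.length), tallies (2 ^ w.length), w] := fun w =>
    hc (2 ^ 2 ^ w.length) ((((), w), 2 ^ w.length), 2 ^ 2 ^ w.length) (envLE_prod.2
      ⟨(Feas.rep_nat_length _).le, envLE_prod.2 ⟨(Feas.rep_nat_length _).le.trans (hlt _),
        envLE_prod.2 ⟨(hlt w.length).trans (hlt _), by simp [EnvLE, Ctx.env]⟩⟩⟩)
  have hl : ∀ w : List Symbol, (tallies (2 ^ w.length)).length = 2 ^ w.length := fun w =>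
    List.length_replicate ..
  refine mem_twoEXPTIME (.bind doubling (.bind doubling c)) (k + 1) (fun w => ?_) fun w => ?_
  · rw [Code.eval, Code.eval, eval_doubling, eval_doubling, hl, (hw w).1, accepts_iff_mem]
    rfl
  · have h₁ : 2 ^ 2 ^ w.length ≤ 2 ^ 2 ^ (w.length + (k + 1)) :=
      Nat.pow_le_pow_right (by omega) (Nat.pow_le_pow_right (by omega) (Nat.le_add_right _ _))
    rw [Code.Fits, Code.Fits, eval_doubling, eval_doubling, hl]
    refine ⟨(fits_doubling w []).mono ((hlt _).trans h₁), ?_,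
      (hw w).2.mono ((add_two_le_tower _ _).trans (by rw [add_assoc]))⟩
    have h₂ := fits_doubling (tallies (2 ^ w.length)) [w]
    rw [hl] at h₂
    exact h₂.mono h₁

end AdaptiveSync

theorem mainTheorem5 :
    AdaptiveSync.specialSync ∈ AdaptiveSync.TwoEXPTIME AdaptiveSync.Symbol :=
  AdaptiveSync.specialSync_mem_twoEXPTIME
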